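/- Consider the ground state of the infinite one-dimensional free-fermion chain with Fermi momentum $k$, and let $m\ge 1$ adjacent strips of consecutive sites have fixed integer widths $w_1,\dots,w_m\ge 1$. For a nonempty $X\subseteq\{1,\dots,m\}$ let $n_X=\sum_{i\in X}w_i$, and let $C_X(k)$ be the correlation matrix of the sites in the strips of $X$, with entries $\frac{\sin k(x-y)}{\pi(x-y)}$ and diagonal entries $k/\pi$. For $\alpha>0$, $\alpha\neq1$, put $$h_\alpha(\lambda)=\frac{\ln\left(\lambda^\alpha+(1-\lambda)^\alpha\right)}{1-\alpha},\qquad I_m^{(\alpha)}(k)=\sum_{X\ne\emptyset}(-1)^{|X|+1}\,\mathrm{Tr}\,h_\alpha(C_X(k)),$$ the Rényi-$\alpha$ $m$-partite information. Let $\sigma_p=\sum_{X\neq\emptyset}(-1)^{|X|+1}n_X^p$ for integers $p \ge 0$ and $F_\alpha=\sum_{X\neq\emptyset}(-1)^{|X|+1}n_X^\alpha$. A function $f$ has scaling exponent $\beta$ if $f(k)/k^\beta$ tends to a finite nonzero limit as $k\to0^+$; write $\beta_m(\alpha)$ for the scaling exponent of $I_m^{(\alpha)}$. (As the widths are fixed,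 exponents in $k$ and in $z=k w$, for a reference width $w$, agree.) **(a)** Let $\alpha>0$ be non-integer and set $$A_\alpha=\frac{F_\alpha}{(1-\alpha)\,\pi^\alpha},\qquad B_m=\frac{\alpha}{(\alpha-1)\,m}\,\frac{\sigma_m}{\pi^m}.$$ Then $F_\alpha$, $\sigma_m$, $A_\alpha$ and $B_m$ are nonzero, and as $k\to0^+$ $$I_m^{(\alpha)}(k)=A_\alpha k^\alpha+B_m k^m+o\left(k^{\min(\alpha,m)}\right).$$ More precisely, write $h_\alpha=h_\alpha^{\mathrm{frac}}+h_\alpha^{\mathrm{poly}}$ with $h^{\mathrm{frac}}_\alpha(\lambda)=\frac{1}{1-\alpha}\ln\left(1+\left(\frac{\lambda}{1-\lambda}\right)^\alpha\right)$ and $h^{\mathrm{poly}}_\alpha(\lambda)=\frac{\alpha}{1-\alpha}\ln(1-\lambda)$. For all sufficiently small $k>0$, $I_m^{(\alpha)}(k)$ is the sum of the two combinations $\sum_{X\ne\emptyset}(-1)^{|X|+1}\mathrm{Tr}\,h(C_X(k))$ with $h=h_\alpha^{\mathrm{frac}}$ (the fractional channel) and $h=h_\alpha^{\mathrm{poly}}$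 (the polynomial channel); the first is $A_\alpha k^\alpha+o(k^\alpha)$ and the second is $B_m k^m+o(k^m)$. The scaling exponent exists and $\beta_m(\alpha)=\min(\alpha,m)$. **(b)** Let $n\ge2$ be an integer. There is no fractional channel: $h_n$ is real analytic at $0$, $I_m^{(n)}$ is real analytic in $k$ at $k=0$, and $F_n=0$ if $n<m$. With $c_m$ the $m$-th Taylor coefficient of $h_n$ at $0$ (possibly zero), $$I_m^{(n)}(k)=c_m\,\frac{\sigma_m}{\pi^m}\,k^m+o(k^m)\qquad(k\to0^+).$$ The scaling exponent exists and $\beta_m(n)\ge m$. **(c)** For all widths, $\beta_3(2)=3$, $\beta_3(3)=4$, $\beta_4(2)=\beta_4(3)=4$ and $\beta_4(4)=5$. -/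

import Mathlib

open Filter Topology Asymptotics

noncomputable section

namespace FreeFermion

/-- The ground-state correlation matrix `⟨c†_x c_y⟩` of the infinite free-fermion chain with Fermi
momentum `k`, restricted to a finite set `B` of sites: the discrete sine kernel
`sin (k (x - y)) / (π (x - y))`, with diagonal entries `k / π`. It is written with the
continuous function `Real.sinc t = sin t / t`, `Real.sinc 0 = 1`. -/
def corrMatrix (k : ℝ) (B : Finset ℕ) : Matrix B B ℝ :=
  Matrix.of fun x y => k / Real.pi * Real.sinc (k * ((x : ℕ) - (y : ℕ) : ℝ))

/-- The entries of the correlation matrix in their usual form. -/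
theorem corrMatrix_apply (k : ℝ) (B : Finset ℕ) (x y : B) :
    corrMatrix k B x y = if x = y then k / Real.pi else
      Real.sin (k * ((x : ℕ) - (y : ℕ) : ℝ)) / (Real.pi * ((x : ℕ) - (y : ℕ) : ℝ)) := by
  unfold corrMatrix
  by_cases h : x = y
  · simp [h]
  · have hd : ((x : ℕ) - (y : ℕ) : ℝ) ≠ 0 := by
      rw [sub_ne_zero]
      exact_mod_cast fun e => h (Subtype.ext e)
    by_cases hk : k = 0
    · simp [hk]
    · rw [if_neg h, Matrix.of_apply, Real.sinc_of_ne_zero (mul_ne_zero hk hd)]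
      field_simp

theorem corrMatrix_isHermitian (k : ℝ) (B : Finset ℕ) : (corrMatrix k B).IsHermitian := by
  ext x y
  simp only [corrMatrix, Matrix.conjTranspose_apply, Matrix.of_apply, star_trivial]
  rw [← Real.sinc_neg]
  congr 2
  ring

/-- `Tr f(C_B)`: the sum of `f` over the eigenvalues, with multiplicity, of the correlation
matrix of the set of sites `B`. -/
def spectralSum (f : ℝ → ℝ) (k : ℝ) (B : Finset ℕ) : ℝ :=
  ∑ i, f ((corrMatrix_isHermitian k B).eigenvalues i)

/-- The Rényi entropy of index `α ≠ 1` of one fermionic mode with occupation `x`. -/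
def renyiFun (α x : ℝ) : ℝ := Real.log (x ^ α + (1 - x) ^ α) / (1 - α)

/-- The part of `renyiFun α` that carries the non-analytic powers at `x = 0`, beginning with
`x ^ α / (1 - α)`. -/
def renyiFrac (α x : ℝ) : ℝ := Real.log (1 + (x / (1 - x)) ^ α) / (1 - α)

/-- The part of `renyiFun α` that is analytic at `x = 0` for every `α`. -/
def renyiPoly (α x : ℝ) : ℝ := α * Real.log (1 - x) / (1 - α)

theorem renyiFun_eq_add {α x : ℝ} (hx0 : 0 ≤ x) (hx1 : x < 1) :
    renyiFun α x = renyiFrac α x + renyiPoly α x := by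
  unfold renyiFun renyiFrac renyiPoly
  have h1 : 0 < 1 - x := by linarith
  have h2 : 0 < (1 - x) ^ α := Real.rpow_pos_of_pos h1 α
  have h3 : 0 ≤ (x / (1 - x)) ^ α := Real.rpow_nonneg (div_nonneg hx0 h1.le) α
  have h4 : x ^ α + (1 - x) ^ α = (1 + (x / (1 - x)) ^ α) * (1 - x) ^ α := by
    rw [Real.div_rpow hx0 h1.le]
    field_simp
    ring
  rw [h4, Real.log_mul (by positivity) h2.ne', Real.log_rpow h1]
  ring

variable {m : ℕ}

/-- The `i`-th of `m` adjacent strips of widths `w 0, …, w (m - 1)`, as a set of consecutive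
sites of the chain. -/
def strip (w : Fin m → ℕ) (i : Fin m) : Finset ℕ :=
  Finset.Ico (∑ j ∈ Finset.Iio i, w j) (∑ j ∈ Finset.Iic i, w j)

/-- The block formed by the strips with index in `X`. -/
def block (w : Fin m → ℕ) (X : Finset (Fin m)) : Finset ℕ := X.biUnion (strip w)

/-- Inclusion-exclusion over all nonempty families `X` of strips:
`∑_X (-1) ^ (|X| + 1) s(X)`. -/
def inclExcl (s : Finset (Fin m) → ℝ) : ℝ :=
  ∑ X : Finset (Fin m) with X.Nonempty, (-1 : ℝ) ^ (X.card + 1) * s X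

/-- The inclusion-exclusion combination of the traces `Tr f(C_X)` over all blocks `X`. -/
def channel (f : ℝ → ℝ) (w : Fin m → ℕ) (k : ℝ) : ℝ :=
  inclExcl fun X => spectralSum f k (block w X)

/-- The Rényi-`α` entropy of a block, for `α ≠ 1`. -/
def renyiEntropy (α : ℝ) (w : Fin m → ℕ) (k : ℝ) (X : Finset (Fin m)) : ℝ :=
  spectralSum (renyiFun α) k (block w X)

/-- The Rényi-`α` `m`-partite information of the `m` adjacent strips, for `α ≠ 1`. -/
def renyiInfo (α : ℝ) (w : Fin m → ℕ) (k : ℝ) : ℝ := inclExcl (renyiEntropy α w k)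

/-- The moment `σ_p = ∑_X (-1) ^ (|X| + 1) n_X ^ p`, where `n_X` is the total width of `X`. -/
def moment (w : Fin m → ℕ) (p : ℕ) : ℝ := inclExcl fun X => (∑ i ∈ X, (w i : ℝ)) ^ p

/-- The fractional moment `F_α = ∑_X (-1) ^ (|X| + 1) n_X ^ α`. -/
def fracMoment (w : Fin m → ℕ) (α : ℝ) : ℝ := inclExcl fun X => (∑ i ∈ X, (w i : ℝ)) ^ α

/-- The coefficient `A_α` of the fractional channel. -/
def fracCoeff (w : Fin m → ℕ) (α : ℝ) : ℝ :=
  fracMoment w α / ((1 - α) * Real.pi ^ α)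

/-- The coefficient `B_m` of the polynomial channel at non-integer `α`: the `m`-th Taylor
coefficient of `renyiPoly α` times `σ_m / π ^ m`. -/
def polyCoeff (w : Fin m → ℕ) (α : ℝ) : ℝ :=
  α / ((α - 1) * m) * (moment w m / Real.pi ^ m)

/-- `f` has scaling exponent `β` at `0+`: `f k ~ c * k ^ β` for some constant `c ≠ 0`. -/
def HasScalingExponent (f : ℝ → ℝ) (β : ℝ) : Prop :=
  ∃ c : ℝ, c ≠ 0 ∧ Tendsto (fun k => f k / k ^ β) (𝓝[>] 0) (𝓝 c)

end FreeFermion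

end

/-!
The correlation matrix of a block of `N` sites is `k / π` times a matrix with entries
`sinc (k (x - y))`, which is the all-ones matrix at `k = 0`. So all its eigenvalues are `O(k)`,
one of them is `N k / π` to leading order, and the others are negligible. This has two consequences.

* If `f` has a Taylor expansion at `0`, only the powers of order at least `m` contribute to its
  channel: `Tr C_X ^ p` is a sum over cyclic paths of `p` sites, hence a polynomial of degree at
  most `p` in the indicators `[i ∈ X]`, and inclusion-exclusion annihilates such polynomials for
  `p < m` (`channel_pow_eq_zero`). A power `p ≥ 1` contributes `σ_p (k / π) ^ p` to leading order
  (`isLittleO_channel_pow`), so the first nonzero coefficient of order `q ≥ m` gives the leading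
  term of the channel (`isLittleO_channel`).
* For real `α > 0`, `Tr C_X ^ α` is `(N k / π) ^ α` to leading order
  (`tendsto_spectralSum_rpow`). Here `k > 0` and the positivity of the sine kernel enter.

The moments `F_α` and `σ_p` are, up to sign, iterated differences of a power function. By the mean
value theorem they equal `α (α - 1) ⋯ (α - m + 1)` up to a positive factor and a sign
(`exists_fracMoment_eq`), which decides exactly when they vanish.

At integer index `n` the information is a combination of `log det P(C_X)` with
`P = x ^ n + (1 - x) ^ n > 0`, hence real analytic on the whole line, and its scaling exponent is
its order of vanishing at `0`, provided that it is not identically zero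
(`not_eventually_renyiInfo_natCast_eq_zero`). For this, note that a shift of `k` by `2 π j` adds
`2 j` to the spectrum. If the information vanished identically, its leading term at `2 π j` would show
that the derivative of order `m` of `log P` vanishes at `2 j`, for every `j`; but this derivative is
a nonzero rational function (`logDerivNumerator_ne_zero`). For three and four strips the exponents
are read off from explicit Taylor polynomials of the Rényi functions.
-/

noncomputable section

namespace FreeFermion

/-! ### Iterated differences of power functions -/

section AlternatingSum

variable {ι : Type*}

/-- The alternating sum `∑_{X ⊆ s} (-1) ^ |X| (x + ∑_{i ∈ X} w i) ^ β`, that is, up to the sign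
`(-1) ^ |s|`, the iterated difference at `x` of the power function with steps `w i`, `i ∈ s`. -/
def altPowSum (w : ι → ℝ) (s : Finset ι) (β x : ℝ) : ℝ :=
  ∑ X ∈ s.powerset, (-1 : ℝ) ^ X.card * (x + ∑ i ∈ X, w i) ^ β

theorem altPowSum_insert [DecidableEq ι] {w : ι → ℝ} {s : Finset ι} {a : ι} (ha : a ∉ s)
    (β x : ℝ) :
    altPowSum w (insert a s) β x = altPowSum w s β x - altPowSum w s β (x + w a) := by
  unfold altPowSum
  rw [Finset.sum_powerset_insert ha, sub_eq_add_neg, ← Finset.sum_neg_distrib]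
  congr 1
  refine Finset.sum_congr rfl fun X hX => ?_
  have haX : a ∉ X := fun h => ha (Finset.mem_powerset.1 hX h)
  rw [Finset.card_insert_of_notMem haX, Finset.sum_insert haX, pow_succ, add_assoc]
  ring

theorem hasDerivAt_altPowSum {w : ι → ℝ} (hw : ∀ i, 0 < w i) (s : Finset ι) (β : ℝ) {x : ℝ}
    (hx : 0 < x) :
    HasDerivAt (altPowSum w s β) (β * altPowSum w s (β - 1) x) x := by
  unfold altPowSum
  rw [Finset.mul_sum]
  refine HasDerivAt.fun_sum fun X _ => ?_
  have hpos : 0 < x + ∑ i ∈ X, w i :=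
    add_pos_of_pos_of_nonneg hx (Finset.sum_nonneg fun i _ => (hw i).le)
  have h := (((hasDerivAt_id' x).add_const (∑ i ∈ X, w i)).rpow_const
    (p := β) (Or.inl hpos.ne')).const_mul ((-1 : ℝ) ^ X.card)
  exact h.congr_deriv (by ring)

/-- Mean value theorem for one difference. The left end point `x = 0` is allowed for positive
exponents, where the power function is continuous but possibly not differentiable. -/
theorem exists_altPowSum_insert [DecidableEq ι] {w : ι → ℝ} (hw : ∀ i, 0 < w i) {s : Finset ι}
    {a : ι} (ha : a ∉ s) {β x : ℝ} (hx : 0 ≤ x) (h : 0 < x ∨ 0 < β) :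
    ∃ y, 0 < y ∧ altPowSum w (insert a s) β x = -(w a * (β * altPowSum w s (β - 1) y)) := by
  have hcont : ContinuousOn (altPowSum w s β) (Set.Icc x (x + w a)) := by
    unfold altPowSum
    refine continuousOn_finsetSum _ fun X _ => continuousOn_const.mul ?_
    refine ContinuousOn.rpow_const (by fun_prop) fun y hy => ?_
    rcases h with h | h
    · left
      have := Finset.sum_nonneg fun i (_ : i ∈ X) => (hw i).le
      have := hy.1
      linarith
    · exact Or.inr h.le
  obtain ⟨y, hy, hy'⟩ := exists_hasDerivAt_eq_slope (altPowSum w s β)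
    (fun y => β * altPowSum w s (β - 1) y) (lt_add_of_pos_right x (hw a)) hcont
    fun y hy => hasDerivAt_altPowSum hw s β (hx.trans_lt hy.1)
  refine ⟨y, hx.trans_lt hy.1, ?_⟩
  rw [altPowSum_insert ha, hy', add_sub_cancel_left, mul_div_cancel₀ _ (hw a).ne', neg_sub]

theorem exists_altPowSum_eq [DecidableEq ι] {w : ι → ℝ} (hw : ∀ i, 0 < w i) (s : Finset ι) (β : ℝ)
    {x : ℝ} (hx : 0 < x) :
    ∃ y, 0 < y ∧
      altPowSum w s β x = (-1) ^ s.card * (∏ j ∈ Finset.range s.card, (β - j)) * y := by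
  induction s using Finset.induction_on generalizing β x with
  | empty => exact ⟨x ^ β, Real.rpow_pos_of_pos hx β, by simp [altPowSum]⟩
  | insert a s ha ih =>
    obtain ⟨z, hz, hz'⟩ := exists_altPowSum_insert hw ha (β := β) hx.le (Or.inl hx)
    obtain ⟨y, hy, hy'⟩ := ih (β - 1) hz
    refine ⟨w a * y, mul_pos (hw a) hy, ?_⟩
    rw [hz', hy', Finset.card_insert_of_notMem ha, Finset.prod_range_succ', pow_succ]
    have : ∏ j ∈ Finset.range s.card, (β - ((j + 1 : ℕ) : ℝ)) =
        ∏ j ∈ Finset.range s.card, (β - 1 - (j : ℝ)) :=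
      Finset.prod_congr rfl fun j _ => by push_cast; ring
    rw [this]
    push_cast
    ring

theorem exists_altPowSum_zero_eq [DecidableEq ι] {w : ι → ℝ} (hw : ∀ i, 0 < w i) {s : Finset ι}
    (hs : s.Nonempty) {β : ℝ} (hβ : 0 < β) :
    ∃ y, 0 < y ∧
      altPowSum w s β 0 = (-1) ^ s.card * (∏ j ∈ Finset.range s.card, (β - j)) * y := by
  obtain ⟨a, ha⟩ := hs
  obtain ⟨z, hz, hz'⟩ := exists_altPowSum_insert hw (Finset.notMem_erase a s) le_rfl
    (Or.inr hβ : (0 : ℝ) < 0 ∨ 0 < β)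
  rw [Finset.insert_erase ha] at hz'
  obtain ⟨y, hy, hy'⟩ := exists_altPowSum_eq hw (s.erase a) (β - 1) hz
  refine ⟨w a * y, mul_pos (hw a) hy, ?_⟩
  have hc : s.card = (s.erase a).card + 1 := (Finset.card_erase_add_one ha).symm
  rw [hz', hy', hc, Finset.prod_range_succ', pow_succ]
  have : ∏ j ∈ Finset.range (s.erase a).card, (β - ((j + 1 : ℕ) : ℝ)) =
      ∏ j ∈ Finset.range (s.erase a).card, (β - 1 - (j : ℝ)) :=
    Finset.prod_congr rfl fun j _ => by push_cast; ring
  rw [this]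
  push_cast
  ring

end AlternatingSum

/-! ### Inclusion-exclusion and the moments -/

section InclusionExclusion

variable {m : ℕ}

theorem inclExcl_add (s t : Finset (Fin m) → ℝ) :
    inclExcl (fun X => s X + t X) = inclExcl s + inclExcl t := by
  simp only [inclExcl, mul_add, Finset.sum_add_distrib]

theorem inclExcl_const_mul (c : ℝ) (s : Finset (Fin m) → ℝ) :
    inclExcl (fun X => c * s X) = c * inclExcl s := by
  simp only [inclExcl, Finset.mul_sum, mul_left_comm]

theorem inclExcl_sub (s t : Finset (Fin m) → ℝ) :
    inclExcl (fun X => s X - t X) = inclExcl s - inclExcl t := by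
  simp only [inclExcl, mul_sub, Finset.sum_sub_distrib]

theorem inclExcl_sum {ι : Type*} (I : Finset ι) (s : ι → Finset (Fin m) → ℝ) :
    inclExcl (fun X => ∑ i ∈ I, s i X) = ∑ i ∈ I, inclExcl (s i) := by
  simp only [inclExcl, Finset.mul_sum]
  exact Finset.sum_comm

theorem inclExcl_congr {s t : Finset (Fin m) → ℝ} (h : ∀ X, X.Nonempty → s X = t X) :
    inclExcl s = inclExcl t :=
  Finset.sum_congr rfl fun X hX => by rw [h X (Finset.mem_filter.1 hX).2]

theorem isLittleO_inclExcl {f : Finset (Fin m) → ℝ → ℝ} {g : ℝ → ℝ} {l : Filter ℝ}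
    (h : ∀ X, X.Nonempty → f X =o[l] g) : (fun k => inclExcl fun X => f X k) =o[l] g :=
  IsLittleO.fun_sum fun X hX => (h X (Finset.mem_filter.1 hX).2).const_mul_left _

/-- A function that vanishes on the empty family may be summed over all families. -/
theorem inclExcl_eq_neg_sum {s : Finset (Fin m) → ℝ} (h : s ∅ = 0) :
    inclExcl s = -∑ X, (-1 : ℝ) ^ X.card * s X := by
  unfold inclExcl
  rw [← Finset.sum_neg_distrib, Finset.sum_filter]
  refine Finset.sum_congr rfl fun X _ => ?_
  split_ifs with hX
  · ring
  · rw [Finset.not_nonempty_iff_eq_empty.1 hX, h]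
    simp

/-- The sign of the fractional moment is that of `(-1) ^ (m + 1) α (α - 1) ⋯ (α - m + 1)`. -/
theorem exists_fracMoment_eq (hm : 0 < m) {w : Fin m → ℕ} (hw : ∀ i, 0 < w i) {α : ℝ}
    (hα : 0 < α) :
    ∃ y, 0 < y ∧
      fracMoment w α = (-1) ^ (m + 1) * (∏ j ∈ Finset.range m, (α - j)) * y := by
  have : Nonempty (Fin m) := ⟨⟨0, hm⟩⟩
  obtain ⟨y, hy, hy'⟩ := exists_altPowSum_zero_eq (w := fun i => (w i : ℝ))
    (fun i => Nat.cast_pos.2 (hw i)) (Finset.univ_nonempty (α := Fin m)) hα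
  refine ⟨y, hy, ?_⟩
  rw [fracMoment, inclExcl_eq_neg_sum (by simp [hα.ne'])]
  simp only [altPowSum, zero_add, Finset.powerset_univ, Finset.card_univ, Fintype.card_fin] at hy'
  rw [hy']
  ring

theorem fracMoment_ne_zero (hm : 0 < m) {w : Fin m → ℕ} (hw : ∀ i, 0 < w i) {α : ℝ}
    (hα : 0 < α) (h : ∀ j < m, α ≠ j) : fracMoment w α ≠ 0 := by
  obtain ⟨y, hy, hy'⟩ := exists_fracMoment_eq hm hw hα
  rw [hy']
  refine mul_ne_zero (mul_ne_zero (by simp) (Finset.prod_ne_zero_iff.2 fun j hj => ?_)) hy.ne'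
  exact sub_ne_zero.2 (h j (Finset.mem_range.1 hj))

theorem fracMoment_natCast_eq_zero {w : Fin m → ℕ} (hw : ∀ i, 0 < w i) {n : ℕ}
    (hn : 0 < n) (hnm : n < m) : fracMoment w n = 0 := by
  obtain ⟨y, -, hy⟩ := exists_fracMoment_eq (hn.trans hnm) hw (Nat.cast_pos.2 hn : (0 : ℝ) < n)
  rw [hy, Finset.prod_eq_zero (Finset.mem_range.2 hnm) (sub_self _)]
  simp

theorem moment_ne_zero (hm : 0 < m) {w : Fin m → ℕ} (hw : ∀ i, 0 < w i) {p : ℕ} (hp : m ≤ p) :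
    moment w p ≠ 0 := by
  have h := fracMoment_ne_zero hm hw (Nat.cast_pos.2 (hm.trans_le hp) : (0 : ℝ) < p)
    fun j hj => Nat.cast_injective.ne (hj.trans_le hp).ne'
  simpa only [fracMoment, Real.rpow_natCast, moment] using h

/-! ### Functions of low degree in the families of strips -/

/-- The indicator of the families that contain `S`: the monomial `∏_{i ∈ S} [i ∈ X]`. -/
def superInd (S X : Finset (Fin m)) : ℝ := if S ⊆ X then 1 else 0

/-- The functions of a family `X` of strips that are polynomials of degree at most `p` in the
indicators `[i ∈ X]`. -/
def degreeLE (m p : ℕ) : Submodule ℝ (Finset (Fin m) → ℝ) :=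
  Submodule.span ℝ (superInd '' {S | S.card ≤ p})

theorem superInd_mem_degreeLE {S : Finset (Fin m)} {p : ℕ} (h : S.card ≤ p) :
    superInd S ∈ degreeLE m p :=
  Submodule.subset_span ⟨S, h, rfl⟩

theorem mul_mem_degreeLE {p q : ℕ} {s t : Finset (Fin m) → ℝ} (hs : s ∈ degreeLE m p)
    (ht : t ∈ degreeLE m q) : s * t ∈ degreeLE m (p + q) := by
  have h := Submodule.mul_mem_mul hs ht
  rw [degreeLE, degreeLE, Submodule.span_mul_span] at h
  refine Submodule.span_le.2 ?_ h
  rintro _ ⟨_, ⟨S, hS, rfl⟩, _, ⟨T, hT, rfl⟩, rfl⟩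
  have : superInd S * superInd T = superInd (S ∪ T) := by
    funext X
    by_cases h1 : S ⊆ X <;> by_cases h2 : T ⊆ X <;>
      simp [superInd, Finset.union_subset_iff, h1, h2]
  simp only [this]
  exact superInd_mem_degreeLE ((Finset.card_union_le S T).trans (add_le_add hS hT))

theorem sum_neg_one_pow_mul_superInd {S : Finset (Fin m)} (hS : S.card < m) :
    ∑ X, (-1 : ℝ) ^ X.card * superInd S X = 0 := by
  obtain ⟨a, ha⟩ : ∃ a, a ∉ S := by
    by_contra! h
    rw [Finset.eq_univ_iff_forall.2 h, Finset.card_univ, Fintype.card_fin] at hS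
    exact hS.false
  -- adding the element `a` to a family changes the sign and not the indicator
  rw [← Finset.powerset_univ, ← Finset.insert_erase (Finset.mem_univ a),
    Finset.sum_powerset_insert (Finset.notMem_erase _ _), ← Finset.sum_add_distrib]
  refine Finset.sum_eq_zero fun X hX => ?_
  have haX : a ∉ X := fun h => Finset.notMem_erase a _ (Finset.mem_powerset.1 hX h)
  rw [Finset.card_insert_of_notMem haX]
  simp only [superInd, Finset.subset_insert_iff_of_notMem ha]
  ring

/-- Inclusion-exclusion annihilates the polynomials of degree less than `m` in the indicators. -/
theorem inclExcl_eq_zero_of_mem_degreeLE {p : ℕ} (hp : p < m) {s : Finset (Fin m) → ℝ}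
    (hs : s ∈ degreeLE m p) (h : s ∅ = 0) : inclExcl s = 0 := by
  rw [inclExcl_eq_neg_sum h, neg_eq_zero]
  clear h
  induction hs using Submodule.span_induction with
  | mem s hs =>
    obtain ⟨S, hS, rfl⟩ := hs
    exact sum_neg_one_pow_mul_superInd (lt_of_le_of_lt hS hp)
  | zero => simp
  | add s t _ _ hs ht => simp only [Pi.add_apply, mul_add, Finset.sum_add_distrib, hs, ht, add_zero]
  | smul c s _ hs =>
    simp only [Pi.smul_apply, smul_eq_mul, mul_left_comm _ c, ← Finset.mul_sum, hs, mul_zero]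

end InclusionExclusion

/-! ### Strips and blocks -/

section Strips

variable {m : ℕ}

theorem eq_of_mem_strip {w : Fin m → ℕ} {i j : Fin m} {x : ℕ} (hi : x ∈ strip w i)
    (hj : x ∈ strip w j) : i = j := by
  have key : ∀ {i j : Fin m}, x ∈ strip w i → x ∈ strip w j → ¬ i < j := by
    intro i j hi hj hij
    have h1 := (Finset.mem_Ico.1 hi).2
    have h2 := (Finset.mem_Ico.1 hj).1
    have h3 : ∑ l ∈ Finset.Iic i, w l ≤ ∑ l ∈ Finset.Iio j, w l :=
      Finset.sum_le_sum_of_subset fun l hl =>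
        Finset.mem_Iio.2 ((Finset.mem_Iic.1 hl).trans_lt hij)
    omega
  exact le_antisymm (not_lt.1 (key hj hi)) (not_lt.1 (key hi hj))

theorem card_strip (w : Fin m → ℕ) (i : Fin m) : (strip w i).card = w i := by
  rw [strip, Nat.card_Ico, ← Finset.Iio_insert, Finset.sum_insert (by simp)]
  omega

theorem card_block (w : Fin m → ℕ) (X : Finset (Fin m)) :
    (block w X).card = ∑ i ∈ X, w i := by
  rw [block, Finset.card_biUnion]
  · exact Finset.sum_congr rfl fun i _ => card_strip w i
  · intro i _ j _ hij
    exact Finset.disjoint_left.2 fun x hi hj => hij (eq_of_mem_strip hi hj)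

theorem block_mono (w : Fin m → ℕ) {X Y : Finset (Fin m)} (h : X ⊆ Y) : block w X ⊆ block w Y :=
  Finset.biUnion_subset_biUnion_of_subset_left _ h

theorem block_nonempty {w : Fin m → ℕ} (hw : ∀ i, 0 < w i) {X : Finset (Fin m)}
    (hX : X.Nonempty) : (block w X).Nonempty := by
  rw [← Finset.card_pos, card_block]
  exact Finset.sum_pos (fun i _ => hw i) hX

theorem mem_block_indicator_mem_degreeLE (w : Fin m → ℕ) (x : ℕ) :
    (fun X => if x ∈ block w X then (1 : ℝ) else 0) ∈ degreeLE m 1 := by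
  by_cases h : ∃ i, x ∈ strip w i
  · obtain ⟨i, hi⟩ := h
    convert superInd_mem_degreeLE (S := {i}) (p := 1) (by simp) using 1
    funext X
    have : x ∈ block w X ↔ {i} ⊆ X := by
      rw [block, Finset.mem_biUnion, Finset.singleton_subset_iff]
      exact ⟨fun ⟨j, hj, hxj⟩ => eq_of_mem_strip hxj hi ▸ hj, fun h => ⟨i, h, hi⟩⟩
    simp only [superInd, this]
  · have : (fun X => if x ∈ block w X then (1 : ℝ) else 0) = 0 := by
      funext X
      refine if_neg fun hx => h ?_
      obtain ⟨i, -, hi⟩ := Finset.mem_biUnion.1 hx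
      exact ⟨i, hi⟩
    rw [this]
    exact zero_mem _

end Strips

/-! ### Polynomials in a Hermitian matrix -/

section Hermitian

variable {n : Type*} [Fintype n] [DecidableEq n] {A : Matrix n n ℝ}

open Polynomial in
theorem aeval_eq_conj_diagonal (hA : A.IsHermitian) (P : ℝ[X]) :
    aeval A P = (hA.eigenvectorUnitary : Matrix n n ℝ) *
      Matrix.diagonal (fun i => P.eval (hA.eigenvalues i)) *
      (star hA.eigenvectorUnitary : Matrix n n ℝ) := by
  have hdiag : ∀ d : n → ℝ,
      aeval (Matrix.diagonal d) P = Matrix.diagonal fun i => P.eval (d i) := by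
    intro d
    have h := aeval_algHom_apply (Matrix.diagonalAlgHom ℝ (n := n) (α := ℝ)) d P
    simp only [Matrix.diagonalAlgHom_apply] at h
    rw [h]
    congr 1
    funext i
    simp [coe_aeval_eq_eval]
  conv_lhs => rw [hA.spectral_theorem]
  have h := aeval_algHom_apply
    (Unitary.conjStarAlgAut ℝ (Matrix n n ℝ) hA.eigenvectorUnitary).toAlgEquiv.toAlgHom
    (Matrix.diagonal hA.eigenvalues) P
  rw [hdiag] at h
  refine h.trans ?_
  exact Unitary.conjStarAlgAut_apply (S := ℝ) (R := Matrix n n ℝ) hA.eigenvectorUnitary _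

open Polynomial in
theorem det_aeval_eq_prod (hA : A.IsHermitian) (P : ℝ[X]) :
    (aeval A P).det = ∏ i, P.eval (hA.eigenvalues i) := by
  rw [aeval_eq_conj_diagonal hA, Matrix.det_mul, Matrix.det_mul, mul_right_comm, ← Matrix.det_mul]
  simp [Matrix.det_diagonal]

open Polynomial in
theorem trace_aeval_eq_sum (hA : A.IsHermitian) (P : ℝ[X]) :
    (aeval A P).trace = ∑ i, P.eval (hA.eigenvalues i) := by
  rw [aeval_eq_conj_diagonal hA, Matrix.trace_mul_comm, ← mul_assoc]
  simp [Matrix.trace_diagonal]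

theorem trace_pow_eq_sum (hA : A.IsHermitian) (p : ℕ) :
    (A ^ p).trace = ∑ i, hA.eigenvalues i ^ p := by
  simpa using trace_aeval_eq_sum hA (Polynomial.X ^ p)

end Hermitian

/-! ### Traces of powers of the correlation matrix -/

section Traces

theorem spectralSum_pow (p k B) :
    spectralSum (fun x => x ^ p) k B = (corrMatrix k B ^ p).trace :=
  (trace_pow_eq_sum (corrMatrix_isHermitian k B) p).symm

/-- The correlation matrix divided by `k`, in a form that is continuous at `k = 0`. -/
def scaledCorrMatrix (k : ℝ) (B : Finset ℕ) : Matrix B B ℝ :=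
  Matrix.of fun x y => Real.pi⁻¹ * Real.sinc (k * ((x : ℕ) - (y : ℕ) : ℝ))

theorem corrMatrix_eq_smul (k : ℝ) (B : Finset ℕ) :
    corrMatrix k B = k • scaledCorrMatrix k B := by
  ext x y
  simp [corrMatrix, scaledCorrMatrix, div_eq_mul_inv, mul_assoc]

theorem continuous_scaledCorrMatrix (B : Finset ℕ) :
    Continuous fun k => scaledCorrMatrix k B := by
  refine continuous_matrix fun x y => ?_
  exact continuous_const.mul (Real.continuous_sinc.comp (by fun_prop))

theorem scaledCorrMatrix_zero_pow_succ (B : Finset ℕ) (p : ℕ) :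
    scaledCorrMatrix 0 B ^ (p + 1) =
      Matrix.of fun _ _ => (B.card : ℝ) ^ p / Real.pi ^ (p + 1) := by
  induction p with
  | zero => ext x y; simp [scaledCorrMatrix]
  | succ p ih =>
    rw [pow_succ, ih]
    ext x y
    have := Real.pi_ne_zero
    simp only [Matrix.mul_apply, Matrix.of_apply, scaledCorrMatrix, zero_mul, Real.sinc_zero,
      Finset.sum_const, Finset.card_univ, Fintype.card_coe, nsmul_eq_mul]
    field_simp
    ring

theorem tendsto_trace_scaledCorrMatrix_pow (B : Finset ℕ) {p : ℕ} (hp : 0 < p) :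
    Tendsto (fun k => (scaledCorrMatrix k B ^ p).trace) (𝓝 0)
      (𝓝 ((B.card : ℝ) ^ p / Real.pi ^ p)) := by
  have h : Continuous fun k => (scaledCorrMatrix k B ^ p).trace :=
    ((continuous_scaledCorrMatrix B).pow p).matrix_trace
  convert h.tendsto 0 using 2
  obtain ⟨p, rfl⟩ := Nat.exists_eq_add_of_lt hp
  rw [zero_add, scaledCorrMatrix_zero_pow_succ]
  simp only [Matrix.trace, Matrix.diag_apply, Matrix.of_apply, Finset.sum_const,
    Finset.card_univ, Fintype.card_coe, nsmul_eq_mul]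
  ring

theorem isLittleO_spectralSum_pow (B : Finset ℕ) {p : ℕ} (hp : 0 < p) :
    (fun k => spectralSum (fun x => x ^ p) k B - (B.card : ℝ) ^ p / Real.pi ^ p * k ^ p)
      =o[𝓝 0] fun k => k ^ p := by
  have h := (isLittleO_one_iff ℝ).2
    (tendsto_sub_nhds_zero_iff.2 (tendsto_trace_scaledCorrMatrix_pow B hp))
  refine ((isBigO_refl (fun k : ℝ => k ^ p) (𝓝 0)).mul_isLittleO h).congr (fun k => ?_) fun k => ?_
  · rw [spectralSum_pow, corrMatrix_eq_smul, smul_pow, Matrix.trace_smul, smul_eq_mul]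
    ring
  · ring

/-- Each eigenvalue is bounded by the Frobenius norm. -/
theorem abs_eigenvalue_le (k : ℝ) (B : Finset ℕ) (i : B) :
    |(corrMatrix_isHermitian k B).eigenvalues i| ≤ B.card / Real.pi * |k| := by
  refine abs_le_of_sq_le_sq' ?_ (by positivity) |> abs_le.2
  calc (corrMatrix_isHermitian k B).eigenvalues i ^ 2
      ≤ ∑ j, (corrMatrix_isHermitian k B).eigenvalues j ^ 2 :=
        Finset.single_le_sum (f := fun j => (corrMatrix_isHermitian k B).eigenvalues j ^ 2)
          (fun j _ => sq_nonneg _) (Finset.mem_univ i)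
    _ = ∑ x : B, ∑ y : B, corrMatrix k B x y * corrMatrix k B y x := by
        rw [← trace_pow_eq_sum, pow_two]
        rfl
    _ ≤ ∑ x : B, ∑ y : B, (k / Real.pi) ^ 2 := by
        refine Finset.sum_le_sum fun x _ => Finset.sum_le_sum fun y _ => ?_
        have hb : ∀ x y : B, |corrMatrix k B x y| ≤ |k / Real.pi| := fun x y => by
          rw [corrMatrix, Matrix.of_apply, abs_mul]
          exact mul_le_of_le_one_right (abs_nonneg _) (Real.abs_sinc_le_one _)
        calc _ ≤ |corrMatrix k B x y| * |corrMatrix k B y x| := by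
              rw [← abs_mul]; exact le_abs_self _
          _ ≤ |k / Real.pi| * |k / Real.pi| :=
              mul_le_mul (hb x y) (hb y x) (abs_nonneg _) (abs_nonneg _)
          _ = (k / Real.pi) ^ 2 := by rw [abs_mul_abs_self, pow_two]
    _ = (B.card / Real.pi * |k|) ^ 2 := by
        simp only [Finset.sum_const, Finset.card_univ, Fintype.card_coe, nsmul_eq_mul]
        rw [mul_pow, sq_abs]
        ring

theorem tendsto_eigenvalue (B : Finset ℕ) (i : B) :
    Tendsto (fun k => (corrMatrix_isHermitian k B).eigenvalues i) (𝓝 0) (𝓝 0) := by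
  refine squeeze_zero_norm (fun k => abs_eigenvalue_le k B i) ?_
  have : Continuous fun k : ℝ => B.card / Real.pi * |k| := by fun_prop
  simpa using this.tendsto 0

theorem isBigO_eigenvalue (B : Finset ℕ) (i : B) (l : Filter ℝ) :
    (fun k => (corrMatrix_isHermitian k B).eigenvalues i) =O[l] fun k => k :=
  IsBigO.of_bound _ (Eventually.of_forall fun k => abs_eigenvalue_le k B i)

theorem isLittleO_spectralSum {g : ℝ → ℝ} {q : ℕ} (hg : g =o[𝓝 0] fun x => x ^ q)
    (B : Finset ℕ) : (fun k => spectralSum g k B) =o[𝓝 0] fun k => k ^ q :=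
  IsLittleO.fun_sum fun i _ => (hg.comp_tendsto (tendsto_eigenvalue B i)).trans_isBigO
    ((isBigO_eigenvalue B i (𝓝 0)).pow q)

end Traces

/-! ### The leading term of an analytic channel -/

section Channel

variable {m : ℕ}

/-- The entry `(x, y)` of the power `p + 1` of the correlation matrix of the block of `X`, written
as a sum over paths through the sites of the union of all strips. Only the `p` intermediate sites
are restricted to the block, so its degree in the indicators `[i ∈ X]` is at most `p`. -/
def pathSum (w : Fin m → ℕ) (k : ℝ) : ℕ → ℕ → ℕ → Finset (Fin m) → ℝ
  | 0, x, y => fun _ => k / Real.pi * Real.sinc (k * ((x : ℝ) - (y : ℝ)))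
  | p + 1, x, y => ∑ z ∈ block w Finset.univ, (k / Real.pi * Real.sinc (k * ((x : ℝ) - (z : ℝ)))) •
      ((fun X => if z ∈ block w X then (1 : ℝ) else 0) * pathSum w k p z y)

theorem pathSum_mem_degreeLE (w : Fin m → ℕ) (k : ℝ) (p x y : ℕ) :
    pathSum w k p x y ∈ degreeLE m p := by
  induction p generalizing x with
  | zero =>
    have := (degreeLE m 0).smul_mem (k / Real.pi * Real.sinc (k * ((x : ℝ) - (y : ℝ))))
      (superInd_mem_degreeLE (S := ∅) (p := 0) le_rfl)
    convert this using 1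
    funext X
    simp [pathSum, superInd]
  | succ p ih =>
    rw [pathSum, add_comm p 1]
    exact Submodule.sum_mem _ fun z _ => Submodule.smul_mem _ _
      (mul_mem_degreeLE (mem_block_indicator_mem_degreeLE w z) (ih z))

theorem corrMatrix_pow_succ_apply (w : Fin m → ℕ) (k : ℝ) (X : Finset (Fin m)) (p : ℕ)
    (x y : block w X) :
    (corrMatrix k (block w X) ^ (p + 1)) x y = pathSum w k p x y X := by
  induction p generalizing x with
  | zero => simp [pathSum, corrMatrix]
  | succ p ih =>
    rw [pow_succ', Matrix.mul_apply]
    simp only [ih, pathSum, Finset.sum_apply, Pi.smul_apply, Pi.mul_apply, smul_eq_mul, ite_mul,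
      one_mul, zero_mul, mul_ite, mul_zero]
    rw [← Finset.sum_filter, Finset.filter_mem_eq_inter,
      Finset.inter_eq_right.2 (block_mono w (Finset.subset_univ X))]
    exact Finset.sum_coe_sort (block w X) fun z =>
      k / Real.pi * Real.sinc (k * ((x : ℝ) - (z : ℝ))) *
      pathSum w k p z y X

/-- A power less than the number of strips has no connected contribution: a cyclic path of
`p < m` sites does not meet all the strips. -/
theorem channel_pow_eq_zero (w : Fin m → ℕ) (k : ℝ) {p : ℕ} (hp : 0 < p) (hpm : p < m) :
    channel (fun x => x ^ p) w k = 0 := by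
  refine inclExcl_eq_zero_of_mem_degreeLE hpm ?_ ?_
  · obtain ⟨p, rfl⟩ := Nat.exists_eq_add_of_lt hp
    have h : (fun X => spectralSum (fun x => x ^ (0 + p + 1)) k (block w X)) =
        ∑ x ∈ block w Finset.univ,
          (fun X => if x ∈ block w X then (1 : ℝ) else 0) * pathSum w k p x x := by
      funext X
      simp only [spectralSum_pow, Matrix.trace, Matrix.diag_apply, zero_add,
        corrMatrix_pow_succ_apply, Finset.sum_apply, Pi.mul_apply, ite_mul, one_mul, zero_mul]
      rw [← Finset.sum_filter, Finset.filter_mem_eq_inter,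
        Finset.inter_eq_right.2 (block_mono w (Finset.subset_univ X))]
      exact Finset.sum_coe_sort (block w X) fun z => pathSum w k p z z X
    rw [h, zero_add, add_comm p 1]
    exact Submodule.sum_mem _ fun x _ =>
      mul_mem_degreeLE (mem_block_indicator_mem_degreeLE w x) (pathSum_mem_degreeLE w k p x x)
  · have : IsEmpty (block w (∅ : Finset (Fin m))) := by
      rw [block, Finset.biUnion_empty]
      infer_instance
    simp [spectralSum]

theorem isLittleO_channel_pow (w : Fin m → ℕ) {p : ℕ} (hp : 0 < p) :
    (fun k => channel (fun x => x ^ p) w k - moment w p / Real.pi ^ p * k ^ p)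
      =o[𝓝 0] fun k => k ^ p := by
  refine (isLittleO_inclExcl fun X _ => isLittleO_spectralSum_pow (block w X) hp).congr_left
    fun k => ?_
  rw [inclExcl_sub, moment, div_mul_eq_mul_div, mul_comm (inclExcl _), ← inclExcl_const_mul,
    div_eq_inv_mul, ← inclExcl_const_mul]
  congr 2
  funext X
  rw [card_block]
  push_cast
  ring

theorem channel_add (f g : ℝ → ℝ) (w : Fin m → ℕ) (k : ℝ) :
    channel (fun x => f x + g x) w k = channel f w k + channel g w k := by
  rw [channel, channel, channel, ← inclExcl_add]
  simp only [spectralSum, Finset.sum_add_distrib]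

theorem channel_sum_pow (c : ℕ → ℝ) (I : Finset ℕ) (w : Fin m → ℕ) (k : ℝ) :
    channel (fun x => ∑ p ∈ I, c p * x ^ p) w k =
      ∑ p ∈ I, c p * channel (fun x => x ^ p) w k := by
  simp only [channel, ← inclExcl_const_mul]
  rw [← inclExcl_sum]
  refine inclExcl_congr fun X _ => ?_
  simp only [spectralSum, Finset.mul_sum]
  exact Finset.sum_comm

/-- The leading term of a channel. The Taylor coefficients of `f` below order `m` do not
contribute at all, and those from `m` to `q - 1` are assumed to vanish, so the coefficient of
order `q` decides. -/
theorem isLittleO_channel (hm : 0 < m) (w : Fin m → ℕ) {f : ℝ → ℝ} {c : ℕ → ℝ} {q : ℕ}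
    (hmq : m ≤ q) (h0 : c 0 = 0) (hc : ∀ p, m ≤ p → p < q → c p = 0)
    (hf : (fun x => f x - ∑ p ∈ Finset.range (q + 1), c p * x ^ p) =o[𝓝 0] fun x => x ^ q) :
    (fun k => channel f w k - c q * (moment w q / Real.pi ^ q) * k ^ q)
      =o[𝓝 0] fun k => k ^ q := by
  have h1 := isLittleO_inclExcl fun X _ => isLittleO_spectralSum hf (block w X)
  have h2 := (isLittleO_channel_pow w (hm.trans_le hmq)).const_mul_left (c q)
  refine (h1.add h2).congr_left fun k => ?_
  have h3 : channel f w k = channel (fun x => (f x - ∑ p ∈ Finset.range (q + 1), c p * x ^ p) +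
      ∑ p ∈ Finset.range (q + 1), c p * x ^ p) w k := by simp only [sub_add_cancel]
  have h4 : ∑ p ∈ Finset.range (q + 1), c p * channel (fun x => x ^ p) w k =
      c q * channel (fun x => x ^ q) w k := by
    rw [Finset.sum_range_succ, add_eq_right]
    refine Finset.sum_eq_zero fun p hp => ?_
    rcases p.eq_zero_or_pos with rfl | hp0
    · rw [h0, zero_mul]
    · rcases lt_or_ge p m with hpm | hpm
      · rw [channel_pow_eq_zero w k hp0 hpm, mul_zero]
      · rw [hc p hpm (Finset.mem_range.1 hp), zero_mul]
  rw [h3, channel_add, channel_sum_pow, h4]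
  simp only [channel]
  ring

end Channel

/-! ### Positivity and the traces of fractional powers -/

theorem mul_sinc_mul_eq_integral (k d : ℝ) : k * Real.sinc (k * d) =
    ∫ q in (0 : ℝ)..k, Real.cos (q * d) := by
  by_cases hd : d = 0
  · simp [hd]
  · rw [intervalIntegral.integral_comp_mul_right _ hd, integral_cos]
    by_cases hk : k = 0
    · simp [hk]
    · rw [Real.sinc_of_ne_zero (mul_ne_zero hk hd)]
      simp only [zero_mul, Real.sin_zero, sub_zero, smul_eq_mul]
      field_simp

/-- The quadratic form of the sine kernel is the integral over the Fermi sea of the squared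
modulus of a trigonometric polynomial. -/
theorem sum_corrMatrix_mul_nonneg {k : ℝ} (hk : 0 ≤ k) (B : Finset ℕ) (v : B → ℝ) :
    0 ≤ ∑ x, ∑ y, v x * corrMatrix k B x y * v y := by
  have h : ∑ x, ∑ y, v x * corrMatrix k B x y * v y = Real.pi⁻¹ * ∫ q in (0 : ℝ)..k,
      ((∑ x : B, v x * Real.cos (q * (x : ℕ))) ^ 2 +
        (∑ x : B, v x * Real.sin (q * (x : ℕ))) ^ 2) := by
    have h1 : ∀ q : ℝ, (∑ x : B, v x * Real.cos (q * (x : ℕ))) ^ 2 +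
        (∑ x : B, v x * Real.sin (q * (x : ℕ))) ^ 2 =
        ∑ x : B, ∑ y : B, v x * v y * Real.cos (q * ((x : ℕ) - (y : ℕ) : ℝ)) := by
      intro q
      simp only [pow_two, Finset.sum_mul_sum, ← Finset.sum_add_distrib, mul_sub, Real.cos_sub]
      exact Finset.sum_congr rfl fun x _ => Finset.sum_congr rfl fun y _ => by ring
    simp only [h1]
    rw [intervalIntegral.integral_finsetSum fun x _ =>
      Continuous.intervalIntegrable (by fun_prop) _ _, Finset.mul_sum]
    refine Finset.sum_congr rfl fun x _ => ?_
    rw [intervalIntegral.integral_finsetSum fun y _ =>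
      Continuous.intervalIntegrable (by fun_prop) _ _, Finset.mul_sum]
    refine Finset.sum_congr rfl fun y _ => ?_
    rw [intervalIntegral.integral_const_mul, ← mul_sinc_mul_eq_integral, corrMatrix,
      Matrix.of_apply]
    ring
  rw [h]
  exact mul_nonneg (inv_nonneg.2 Real.pi_pos.le)
    (intervalIntegral.integral_nonneg hk fun q _ => by positivity)

theorem eigenvalue_nonneg {k : ℝ} (hk : 0 ≤ k) (B : Finset ℕ) (i : B) :
    0 ≤ (corrMatrix_isHermitian k B).eigenvalues i := by
  rw [Matrix.IsHermitian.eigenvalues_eq]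
  have h := sum_corrMatrix_mul_nonneg hk B ((corrMatrix_isHermitian k B).eigenvectorBasis i)
  simpa [dotProduct, Matrix.mulVec, Finset.mul_sum, mul_assoc] using h

theorem tendsto_eigenvalue_nhdsGE (B : Finset ℕ) (i : B) :
    Tendsto (fun k => (corrMatrix_isHermitian k B).eigenvalues i) (𝓝[>] 0) (𝓝[≥] 0) :=
  tendsto_nhdsWithin_iff.2 ⟨(tendsto_eigenvalue B i).mono_left nhdsWithin_le_nhds,
    eventually_nhdsWithin_of_forall fun _ hk => eigenvalue_nonneg (Set.mem_Ioi.1 hk).le B i⟩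

/-- If `μ` can accumulate only at the end points of `[0, L]`, then `φ ∘ μ` tends to `0` for every
continuous `φ` that vanishes there. -/
theorem tendsto_comp_of_tendsto_mul_sub {φ μ : ℝ → ℝ} {L : ℝ} {l : Filter ℝ}
    (hφ : ContinuousOn φ (Set.Icc 0 L)) (h0 : φ 0 = 0) (hL : φ L = 0)
    (hμ : ∀ᶠ k in l, μ k ∈ Set.Icc 0 L) (h : Tendsto (fun k => μ k * (L - μ k)) l (𝓝 0)) :
    Tendsto (fun k => φ (μ k)) l (𝓝 0) := by
  rw [Metric.tendsto_nhds]
  intro ε hε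
  set K := Set.Icc 0 L ∩ (fun t => |φ t|) ⁻¹' Set.Ici ε with hK
  have hKc : IsCompact K := isCompact_Icc.of_isClosed_subset
    (hφ.abs.preimage_isClosed_of_isClosed isClosed_Icc isClosed_Ici) Set.inter_subset_left
  suffices ∀ᶠ k in l, μ k ∉ K by
    filter_upwards [this, hμ] with k hk hk'
    rw [Real.dist_eq, sub_zero]
    by_contra hlt
    exact hk ⟨hk', not_lt.1 hlt⟩
  rcases K.eq_empty_or_nonempty with he | hne
  · simp [he]
  · obtain ⟨t, ht, hmin⟩ := hKc.exists_isMinOn hne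
      (f := fun t => t * (L - t)) (by fun_prop)
    have ht0 : t ≠ 0 := by
      rintro rfl
      have := ht.2
      simp only [Set.mem_preimage, h0, abs_zero, Set.mem_Ici] at this
      linarith
    have htL : t ≠ L := by
      rintro rfl
      have := ht.2
      simp only [Set.mem_preimage, hL, abs_zero, Set.mem_Ici] at this
      linarith
    have hpos : 0 < t * (L - t) :=
      mul_pos (lt_of_le_of_ne ht.1.1 ht0.symm) (sub_pos.2 (lt_of_le_of_ne ht.1.2 htL))
    filter_upwards [h.eventually_lt_const hpos] with k hk hkK
    exact (hk.trans_le (hmin hkK)).false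

theorem sum_eigenvalues (k : ℝ) (B : Finset ℕ) :
    ∑ i, (corrMatrix_isHermitian k B).eigenvalues i = B.card / Real.pi * k := by
  have h := trace_pow_eq_sum (corrMatrix_isHermitian k B) 1
  simp only [pow_one] at h
  rw [← h]
  simp only [Matrix.trace, Matrix.diag_apply, corrMatrix, Matrix.of_apply, sub_self, mul_zero,
    Real.sinc_zero, mul_one, Finset.sum_const, Finset.card_univ, Fintype.card_coe, nsmul_eq_mul]
  ring

/-- For small `k` one eigenvalue is `|B| k / π` to leading order, and all others are negligible.
In the proof the eigenvalues `μ` of `C / k` lie in `[0, L]` with `L = |B| / π`, have sum `L`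
and square sum tending to `L ^ 2`; so every `μ (L - μ)` tends to `0`, which makes `μ ^ α` and
`L ^ (α - 1) μ` asymptotically equal without singling out the largest eigenvalue. -/
theorem tendsto_spectralSum_rpow {B : Finset ℕ} (hB : B.Nonempty) {α : ℝ} (hα : 0 < α) :
    Tendsto (fun k => spectralSum (fun x => x ^ α) k B / k ^ α) (𝓝[>] 0)
      (𝓝 ((B.card / Real.pi) ^ α)) := by
  set L : ℝ := B.card / Real.pi with hL
  have hLpos : 0 < L := div_pos (Nat.cast_pos.2 hB.card_pos) Real.pi_pos
  set μ : B → ℝ → ℝ := fun i k => (corrMatrix_isHermitian k B).eigenvalues i / k with hμ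
  have hmem : ∀ i, ∀ k ∈ Set.Ioi (0 : ℝ), μ i k ∈ Set.Icc 0 L := by
    intro i k hk
    have hk : 0 < k := hk
    refine ⟨div_nonneg (eigenvalue_nonneg hk.le B i) hk.le, (div_le_iff₀ hk).2 ?_⟩
    simpa [abs_of_pos hk] using (le_abs_self _).trans (abs_eigenvalue_le k B i)
  have hsum : ∀ k ∈ Set.Ioi (0 : ℝ), ∑ i, μ i k = L := by
    intro k hk
    rw [← Finset.sum_div, sum_eigenvalues, mul_div_cancel_right₀ _ (ne_of_gt hk)]
  have hsq : Tendsto (fun k => ∑ i, μ i k ^ 2) (𝓝[>] 0) (𝓝 (L ^ 2)) := by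
    have h := (tendsto_trace_scaledCorrMatrix_pow B two_pos).mono_left
      (nhdsWithin_le_nhds (s := Set.Ioi 0))
    rw [hL, div_pow]
    refine h.congr' (eventually_nhdsWithin_of_forall fun k hk => ?_)
    have hk : k ≠ 0 := ne_of_gt hk
    simp only [hμ, div_pow]
    rw [← Finset.sum_div, eq_div_iff (pow_ne_zero 2 hk), ← trace_pow_eq_sum, corrMatrix_eq_smul,
      smul_pow, Matrix.trace_smul, smul_eq_mul, mul_comm]
  have hprod : Tendsto (fun k => ∑ i, μ i k * (L - μ i k)) (𝓝[>] 0) (𝓝 0) := by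
    have h : Tendsto (fun k => L * L - ∑ i, μ i k ^ 2) (𝓝[>] 0) (𝓝 (L * L - L ^ 2)) :=
      tendsto_const_nhds.sub hsq
    rw [← pow_two, sub_self] at h
    refine h.congr' (eventually_nhdsWithin_of_forall fun k hk => ?_)
    simp only [mul_sub, Finset.sum_sub_distrib, ← Finset.sum_mul, hsum k hk, pow_two]
  have hφ : ∀ i, Tendsto (fun k => μ i k ^ α - L ^ (α - 1) * μ i k) (𝓝[>] 0) (𝓝 0) := by
    intro i
    refine tendsto_comp_of_tendsto_mul_sub (φ := fun t => t ^ α - L ^ (α - 1) * t) (L := L)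
      ?_ (by simp [hα.ne']) ?_ (eventually_nhdsWithin_of_forall (hmem i)) ?_
    · exact ((Real.continuous_rpow_const hα.le).sub (by fun_prop)).continuousOn
    · rw [Real.rpow_sub_one hLpos.ne', div_mul_cancel₀ _ hLpos.ne', sub_self]
    · refine squeeze_zero' (eventually_nhdsWithin_of_forall fun k hk => ?_)
        (eventually_nhdsWithin_of_forall fun k hk => ?_) hprod
      · exact mul_nonneg (hmem i k hk).1 (sub_nonneg.2 (hmem i k hk).2)
      · exact Finset.single_le_sum (f := fun i => μ i k * (L - μ i k)) (fun j _ =>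
          mul_nonneg (hmem j k hk).1 (sub_nonneg.2 (hmem j k hk).2)) (Finset.mem_univ i)
  have h := (tendsto_finsetSum Finset.univ fun i _ => hφ i).add_const (L ^ α)
  simp only [Finset.sum_const_zero, zero_add] at h
  refine h.congr' (eventually_nhdsWithin_of_forall fun k hk => ?_)
  have hk' : 0 < k := hk
  simp only [Finset.sum_sub_distrib, ← Finset.mul_sum, hsum k hk]
  rw [Real.rpow_sub_one hLpos.ne', div_mul_cancel₀ _ hLpos.ne', sub_add_cancel, spectralSum,
    Finset.sum_div]
  exact Finset.sum_congr rfl fun i _ => Real.div_rpow (eigenvalue_nonneg hk'.le B i) hk'.le α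

/-! ### The fractional channel -/

theorem isLittleO_renyiFrac_sub {α : ℝ} (hα : 0 < α) :
    (fun x => renyiFrac α x - (1 - α)⁻¹ * x ^ α) =o[𝓝[≥] 0] fun x => x ^ α := by
  have hlog : (fun y : ℝ => Real.log (1 + y) - y) =o[𝓝 0] fun y => y := by
    have h := (Real.hasDerivAt_log one_ne_zero).isLittleO
    have h2 : Tendsto (fun y : ℝ => 1 + y) (𝓝 0) (𝓝 1) := by
      have : Continuous fun y : ℝ => 1 + y := by fun_prop
      simpa using this.tendsto 0
    simpa [Function.comp_def] using h.comp_tendsto h2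
  -- the odds `x / (1 - x)` have power `x ^ α * (1 - x) ^ (-α)`, and the second factor tends to `1`
  have hrho : Tendsto (fun x : ℝ => (1 - x) ^ (-α)) (𝓝[≥] 0) (𝓝 1) := by
    have : ContinuousAt (fun x : ℝ => (1 - x) ^ (-α)) 0 :=
      ContinuousAt.rpow_const (by fun_prop) (by simp)
    simpa using this.tendsto.mono_left nhdsWithin_le_nhds
  have hy : (fun x : ℝ => (x / (1 - x)) ^ α) =ᶠ[𝓝[≥] 0] fun x => x ^ α * (1 - x) ^ (-α) := by
    filter_upwards [self_mem_nhdsWithin, mem_nhdsWithin_of_mem_nhds (Iio_mem_nhds one_pos)]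
      with x hx hx1
    have hx1 : 0 < 1 - x := sub_pos.2 hx1
    rw [Real.div_rpow hx hx1.le, Real.rpow_neg hx1.le, div_eq_mul_inv]
  have hrpow : Tendsto (fun x : ℝ => x ^ α) (𝓝[≥] 0) (𝓝 0) := by
    have := (Real.continuous_rpow_const hα.le).tendsto 0
    rw [Real.zero_rpow hα.ne'] at this
    exact this.mono_left nhdsWithin_le_nhds
  have hy0 : Tendsto (fun x : ℝ => (x / (1 - x)) ^ α) (𝓝[≥] 0) (𝓝 0) := by
    refine Tendsto.congr' hy.symm ?_
    simpa using hrpow.mul hrho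
  have hyO : (fun x : ℝ => (x / (1 - x)) ^ α) =O[𝓝[≥] 0] fun x => x ^ α := by
    refine hy.trans_isBigO ?_
    simpa using (isBigO_refl (fun x : ℝ => x ^ α) (𝓝[≥] 0)).mul (hrho.isBigO_one ℝ)
  have hyo : (fun x : ℝ => (x / (1 - x)) ^ α - x ^ α) =o[𝓝[≥] 0] fun x => x ^ α := by
    have h := (isBigO_refl (fun x : ℝ => x ^ α) (𝓝[≥] 0)).mul_isLittleO
      ((isLittleO_one_iff ℝ).2 (tendsto_sub_nhds_zero_iff.2 hrho))
    refine IsLittleO.congr' h ?_ (by simp)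
    filter_upwards [hy] with x hx
    rw [hx]
    ring
  have h := (((hlog.comp_tendsto hy0).trans_isBigO hyO).add hyo).const_mul_left (1 - α)⁻¹
  refine h.congr_left fun x => ?_
  simp only [Function.comp_apply, renyiFrac]
  ring

theorem isLittleO_spectralSum_renyiFrac {α : ℝ} (hα : 0 < α) {B : Finset ℕ} (hB : B.Nonempty) :
    (fun k => spectralSum (renyiFrac α) k B - (1 - α)⁻¹ * (B.card / Real.pi) ^ α * k ^ α)
      =o[𝓝[>] 0] fun k => k ^ α := by
  have h1 : (fun k => spectralSum (fun x => renyiFrac α x - (1 - α)⁻¹ * x ^ α) k B)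
      =o[𝓝[>] 0] fun k => k ^ α := by
    refine IsLittleO.fun_sum fun i _ =>
      ((isLittleO_renyiFrac_sub hα).comp_tendsto (tendsto_eigenvalue_nhdsGE B i)).trans_isBigO ?_
    exact (isBigO_eigenvalue B i _).rpow hα.le
      (eventually_nhdsWithin_of_forall fun k hk => (Set.mem_Ioi.1 hk).le)
  have h2 : (fun k => (1 - α)⁻¹ * (k ^ α * (spectralSum (fun x => x ^ α) k B / k ^ α -
      (B.card / Real.pi) ^ α))) =o[𝓝[>] 0] fun k => k ^ α := by
    have h := (isBigO_refl (fun k : ℝ => k ^ α) (𝓝[>] 0)).mul_isLittleO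
      ((isLittleO_one_iff ℝ).2 (tendsto_sub_nhds_zero_iff.2 (tendsto_spectralSum_rpow hB hα)))
    exact (h.congr_right (by simp)).const_mul_left _
  refine (h1.add h2).congr' (eventually_nhdsWithin_of_forall fun k hk => ?_) EventuallyEq.rfl
  have hk : k ^ α ≠ 0 := (Real.rpow_pos_of_pos hk α).ne'
  simp only [spectralSum, Finset.sum_sub_distrib, ← Finset.mul_sum]
  field_simp
  ring

variable {m : ℕ}

theorem isLittleO_channel_renyiFrac {α : ℝ} (hα : 0 < α) {w : Fin m → ℕ} (hw : ∀ i, 0 < w i) :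
    (fun k => channel (renyiFrac α) w k - fracCoeff w α * k ^ α) =o[𝓝[>] 0] fun k => k ^ α := by
  refine (isLittleO_inclExcl fun X hX =>
    isLittleO_spectralSum_renyiFrac hα (block_nonempty hw hX)).congr_left fun k => ?_
  have h : fracCoeff w α * k ^ α = ((1 - α)⁻¹ * (Real.pi ^ α)⁻¹ * k ^ α) * fracMoment w α := by
    rw [fracCoeff, div_eq_mul_inv, mul_inv]
    ring
  rw [inclExcl_sub, h, fracMoment, ← inclExcl_const_mul]
  congr 2
  funext X
  rw [card_block, Real.div_rpow (by positivity) Real.pi_pos.le, div_eq_mul_inv]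
  push_cast
  ring

/-! ### The polynomial channel -/

theorem isLittleO_renyiPoly_sub (α : ℝ) (q : ℕ) :
    (fun x => renyiPoly α x - ∑ p ∈ Finset.range (q + 1), α / ((α - 1) * p) * x ^ p)
      =o[𝓝 0] fun x => x ^ q := by
  have h : (fun x : ℝ => (∑ i ∈ Finset.range q, x ^ (i + 1) / (i + 1)) + Real.log (1 - x))
      =O[𝓝 0] fun x => x ^ (q + 1) := by
    refine IsBigO.of_bound 2 ?_
    filter_upwards [Metric.ball_mem_nhds (0 : ℝ) (by norm_num : (0 : ℝ) < 1 / 2)] with x hx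
    rw [Metric.mem_ball, Real.dist_eq, sub_zero] at hx
    refine (Real.abs_log_sub_add_sum_range_le (hx.trans (by norm_num)) q).trans ?_
    rw [div_le_iff₀ (by linarith), norm_pow, Real.norm_eq_abs]
    nlinarith [pow_nonneg (abs_nonneg x) (q + 1)]
  have h2 := (h.trans_isLittleO (isLittleO_pow_pow (lt_add_one q))).const_mul_left (α / (1 - α))
  refine h2.congr_left fun x => ?_
  have hsum : ∑ p ∈ Finset.range (q + 1), α / ((α - 1) * p) * x ^ p =
      -(α / (1 - α) * ∑ i ∈ Finset.range q, x ^ (i + 1) / (i + 1)) := by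
    rw [Finset.sum_range_succ', Finset.mul_sum, ← Finset.sum_neg_distrib]
    simp only [Nat.cast_zero, mul_zero, div_zero, zero_mul, add_zero]
    refine Finset.sum_congr rfl fun i _ => ?_
    rw [← neg_sub 1 α, neg_mul, div_neg, div_mul_eq_div_div]
    push_cast
    ring
  rw [hsum, renyiPoly]
  ring

theorem isLittleO_channel_renyiPoly (hm : 0 < m) (w : Fin m → ℕ) (α : ℝ) :
    (fun k => channel (renyiPoly α) w k - polyCoeff w α * k ^ m) =o[𝓝 0] fun k => k ^ m :=
  isLittleO_channel hm w (c := fun p => α / ((α - 1) * p)) le_rfl (by simp)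
    (fun _ hp hp' => absurd hp' hp.not_gt) (isLittleO_renyiPoly_sub α m)

theorem eventually_renyiInfo_eq_add (α : ℝ) (w : Fin m → ℕ) :
    ∀ᶠ k : ℝ in 𝓝[>] 0,
      renyiInfo α w k = channel (renyiFrac α) w k + channel (renyiPoly α) w k := by
  have h : ∀ X : Finset (Fin m), ∀ᶠ k : ℝ in 𝓝[>] 0, ∀ i : block w X,
      (corrMatrix_isHermitian k (block w X)).eigenvalues i < 1 := fun X =>
    eventually_all.2 fun i => ((tendsto_eigenvalue _ i).mono_left
      nhdsWithin_le_nhds).eventually_lt_const one_pos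
  filter_upwards [eventually_all.2 h, self_mem_nhdsWithin] with k hk hk0
  rw [channel, channel, ← inclExcl_add]
  refine inclExcl_congr fun X _ => ?_
  rw [renyiEntropy, spectralSum, spectralSum, spectralSum, ← Finset.sum_add_distrib]
  exact Finset.sum_congr rfl fun i _ =>
    renyiFun_eq_add (eigenvalue_nonneg (Set.mem_Ioi.1 hk0).le _ i) (hk X i)

theorem hasScalingExponent_of_isLittleO {f : ℝ → ℝ} {c β : ℝ} (hc : c ≠ 0)
    (h : (fun k => f k - c * k ^ β) =o[𝓝[>] 0] fun k : ℝ => k ^ β) : HasScalingExponent f β := by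
  refine ⟨c, hc, ?_⟩
  have h' := h.tendsto_div_nhds_zero.add_const c
  rw [zero_add] at h'
  refine h'.congr' (eventually_nhdsWithin_of_forall fun k hk => ?_)
  have hk : k ^ β ≠ 0 := (Real.rpow_pos_of_pos hk β).ne'
  field_simp
  ring

theorem isLittleO_rpow_rpow {a b : ℝ} (h : a < b) :
    (fun k : ℝ => k ^ b) =o[𝓝[>] 0] fun k : ℝ => k ^ a := by
  have h0 : Tendsto (fun k : ℝ => k ^ (b - a)) (𝓝[>] 0) (𝓝 0) := by
    have := (Real.continuous_rpow_const (sub_pos.2 h).le).tendsto 0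
    rw [Real.zero_rpow (sub_pos.2 h).ne'] at this
    exact this.mono_left nhdsWithin_le_nhds
  have h1 := (isBigO_refl (fun k : ℝ => k ^ a) (𝓝[>] 0)).mul_isLittleO ((isLittleO_one_iff ℝ).2 h0)
  refine h1.congr' (eventually_nhdsWithin_of_forall fun k hk => ?_) (by simp)
  simp only
  rw [← Real.rpow_add hk, add_sub_cancel]

theorem renyiInfo_of_forall_ne_natCast (hm : 0 < m) {w : Fin m → ℕ} (hw : ∀ i, 0 < w i) {α : ℝ}
    (hα : 0 < α) (hn : ∀ n : ℕ, α ≠ n) :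
    fracMoment w α ≠ 0 ∧ fracCoeff w α ≠ 0 ∧ moment w m ≠ 0 ∧ polyCoeff w α ≠ 0 ∧
      (∀ᶠ k : ℝ in 𝓝[>] 0,
        renyiInfo α w k = channel (renyiFrac α) w k + channel (renyiPoly α) w k) ∧
      (fun k : ℝ => channel (renyiFrac α) w k - fracCoeff w α * k ^ α)
        =o[𝓝[>] 0] (fun k : ℝ => k ^ α) ∧
      (fun k : ℝ => channel (renyiPoly α) w k - polyCoeff w α * k ^ m)
        =o[𝓝[>] 0] (fun k : ℝ => k ^ m) ∧
      (fun k : ℝ => renyiInfo α w k - (fracCoeff w α * k ^ α + polyCoeff w α * k ^ m))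
        =o[𝓝[>] 0] (fun k : ℝ => k ^ min α (m : ℝ)) ∧
      HasScalingExponent (renyiInfo α w) (min α (m : ℝ)) := by
  have hF : fracMoment w α ≠ 0 := fracMoment_ne_zero hm hw hα fun j _ => hn j
  have hM : moment w m ≠ 0 := moment_ne_zero hm hw le_rfl
  have hα1 : α ≠ 1 := by simpa using hn 1
  have hm0 : (m : ℝ) ≠ 0 := Nat.cast_ne_zero.2 hm.ne'
  have hA : fracCoeff w α ≠ 0 := div_ne_zero hF
    (mul_ne_zero (sub_ne_zero.2 hα1.symm) (Real.rpow_pos_of_pos Real.pi_pos α).ne')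
  have hB : polyCoeff w α ≠ 0 := mul_ne_zero
    (div_ne_zero hα.ne' (mul_ne_zero (sub_ne_zero.2 hα1) hm0))
    (div_ne_zero hM (pow_ne_zero m Real.pi_ne_zero))
  have hfrac := isLittleO_channel_renyiFrac hα hw
  have hpoly := (isLittleO_channel_renyiPoly hm w α).mono (nhdsWithin_le_nhds (s := Set.Ioi 0))
  have hsplit := eventually_renyiInfo_eq_add α w
  have hO : ∀ {b : ℝ}, min α (m : ℝ) ≤ b →
      (fun k : ℝ => k ^ b) =O[𝓝[>] 0] fun k : ℝ => k ^ min α (m : ℝ) := fun h =>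
    h.eq_or_lt.elim (fun h => h ▸ isBigO_refl _ _) fun h => (isLittleO_rpow_rpow h).isBigO
  have hsum : (fun k : ℝ => renyiInfo α w k - (fracCoeff w α * k ^ α + polyCoeff w α * k ^ m))
      =o[𝓝[>] 0] (fun k : ℝ => k ^ min α (m : ℝ)) := by
    have h1 := hfrac.trans_isBigO (hO (min_le_left _ _))
    have h2 := hpoly.trans_isBigO ((hO (min_le_right α (m : ℝ))).congr_left fun k =>
      Real.rpow_natCast k m)
    refine (h1.add h2).congr' ?_ EventuallyEq.rfl
    filter_upwards [hsplit] with k hk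
    rw [hk]
    ring
  refine ⟨hF, hA, hM, hB, hsplit, hfrac, hpoly, hsum, ?_⟩
  rcases lt_or_gt_of_ne (hn m) with h | h
  · rw [min_eq_left h.le] at hsum ⊢
    refine hasScalingExponent_of_isLittleO hA
      ((hsum.add ((isLittleO_rpow_rpow h).const_mul_left (polyCoeff w α))).congr_left fun k => ?_)
    rw [Real.rpow_natCast]
    ring
  · rw [min_eq_right h.le] at hsum ⊢
    refine hasScalingExponent_of_isLittleO hB
      ((hsum.add ((isLittleO_rpow_rpow h).const_mul_left (fracCoeff w α))).congr_left fun k => ?_)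
    rw [Real.rpow_natCast]
    ring

/-! ### Analyticity at integer index -/

open Polynomial in
/-- The polynomial `x ^ n + (1 - x) ^ n` in the Rényi entropy of integer index `n`. -/
def renyiPolynomial (n : ℕ) : ℝ[X] := X ^ n + (1 - X) ^ n

theorem eval_renyiPolynomial (n : ℕ) (x : ℝ) :
    (renyiPolynomial n).eval x = x ^ n + (1 - x) ^ n := by
  simp [renyiPolynomial]

theorem eval_renyiPolynomial_pos (n : ℕ) (x : ℝ) : 0 < (renyiPolynomial n).eval x := by
  rw [eval_renyiPolynomial]
  rcases n.even_or_odd with h | h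
  · rcases eq_or_ne x 0 with rfl | hx
    · simpa using add_pos_of_nonneg_of_pos (h.pow_nonneg 0) one_pos
    · exact add_pos_of_pos_of_nonneg (h.pow_pos hx) (h.pow_nonneg _)
  · have h1 : (x - 1) ^ n < x ^ n := h.strictMono_pow (sub_one_lt x)
    rw [← neg_sub x 1, h.neg_pow]
    linarith

theorem renyiFun_natCast (n : ℕ) (x : ℝ) :
    renyiFun n x = Real.log ((renyiPolynomial n).eval x) / (1 - n) := by
  rw [renyiFun, Real.rpow_natCast, Real.rpow_natCast, eval_renyiPolynomial]

theorem analyticAt_polynomial_eval (P : Polynomial ℝ) (x : ℝ) :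
    AnalyticAt ℝ (fun y => P.eval y) x :=
  AnalyticOnNhd.eval_polynomial P x (Set.mem_univ x)

theorem analyticAt_renyiFun_natCast (n : ℕ) (x : ℝ) : AnalyticAt ℝ (renyiFun n) x := by
  rw [funext (renyiFun_natCast n)]
  exact ((analyticAt_polynomial_eval _ x).log (eval_renyiPolynomial_pos n x)).div_const

theorem spectralSum_log_eval {P : Polynomial ℝ} (hP : ∀ x, 0 < P.eval x) (c k : ℝ)
    (B : Finset ℕ) :
    spectralSum (fun x => Real.log (P.eval x) / c) k B =
      Real.log (Polynomial.aeval (corrMatrix k B) P).det / c := by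
  rw [det_aeval_eq_prod (corrMatrix_isHermitian k B), Real.log_prod fun i _ => (hP _).ne',
    Finset.sum_div, spectralSum]

theorem analyticAt_aeval_apply {n : Type*} [Fintype n] [DecidableEq n] {A : ℝ → Matrix n n ℝ}
    {k : ℝ} (hA : ∀ x y, AnalyticAt ℝ (fun k => A k x y) k) (P : Polynomial ℝ) (x y : n) :
    AnalyticAt ℝ (fun k => Polynomial.aeval (A k) P x y) k := by
  have hpow : ∀ p x y, AnalyticAt ℝ (fun k => (A k ^ p) x y) k := by
    intro p
    induction p with
    | zero => intro x y; simpa only [pow_zero] using analyticAt_const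
    | succ p ih =>
      intro x y
      simp only [pow_succ, Matrix.mul_apply]
      exact Finset.analyticAt_fun_sum _ fun z _ => (ih x z).mul (hA z y)
  induction P using Polynomial.induction_on' with
  | add P Q hP hQ => simpa only [map_add, Matrix.add_apply] using hP.fun_add hQ
  | monomial p a =>
    simp only [Polynomial.aeval_monomial, ← Algebra.smul_def, Matrix.smul_apply, smul_eq_mul]
    exact analyticAt_const.mul (hpow p x y)

theorem analyticAt_det {n : Type*} [Fintype n] [DecidableEq n] {A : ℝ → Matrix n n ℝ}
    {k : ℝ} (hA : ∀ x y, AnalyticAt ℝ (fun k => A k x y) k) :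
    AnalyticAt ℝ (fun k => (A k).det) k := by
  simp only [Matrix.det_apply, Units.smul_def, zsmul_eq_mul]
  exact Finset.analyticAt_fun_sum _ fun σ _ =>
    analyticAt_const.mul (Finset.analyticAt_fun_prod _ fun i _ => hA _ _)

theorem analyticAt_corrMatrix_apply (B : Finset ℕ) (x y : B) (k : ℝ) :
    AnalyticAt ℝ (fun k => corrMatrix k B x y) k := by
  simp only [corrMatrix_apply]
  split_ifs
  · fun_prop
  · exact (Real.analyticAt_sin.comp (f := fun k : ℝ => k * ((x : ℕ) - (y : ℕ) : ℝ))
      (by fun_prop)).div_const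

theorem analyticAt_spectralSum_log_eval {P : Polynomial ℝ} (hP : ∀ x, 0 < P.eval x) (c k : ℝ)
    (B : Finset ℕ) :
    AnalyticAt ℝ (fun k => spectralSum (fun x => Real.log (P.eval x) / c) k B) k := by
  simp only [spectralSum_log_eval hP]
  refine (AnalyticAt.log (analyticAt_det fun x y =>
    analyticAt_aeval_apply (fun x y => analyticAt_corrMatrix_apply B x y k) P x y) ?_).div_const
  rw [det_aeval_eq_prod (corrMatrix_isHermitian k B)]
  exact Finset.prod_pos fun i _ => hP _

theorem renyiInfo_natCast (n : ℕ) (w : Fin m → ℕ) (k : ℝ) : renyiInfo n w k =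
    channel (fun x => Real.log ((renyiPolynomial n).eval x) / (1 - n)) w k := by
  rw [← funext (renyiFun_natCast n)]
  rfl

/-- At integer index the information is `∑_X ± log det P(C_X) / (1 - n)` with a polynomial `P`
without real zeros, hence analytic on the whole line. -/
theorem analyticAt_renyiInfo_natCast (n : ℕ) (w : Fin m → ℕ) (k : ℝ) :
    AnalyticAt ℝ (renyiInfo n w) k := by
  rw [funext (renyiInfo_natCast n w)]
  unfold channel inclExcl
  exact Finset.analyticAt_fun_sum _ fun X _ =>
    analyticAt_const.mul (analyticAt_spectralSum_log_eval (eval_renyiPolynomial_pos n) _ k _)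

/-- For analytic `f` the Taylor coefficient of order `m`, which may vanish, gives the term of order
`k ^ m`. -/
theorem isLittleO_channel_of_analyticAt (hm : 0 < m) (w : Fin m → ℕ) {f : ℝ → ℝ}
    (hf : AnalyticAt ℝ f 0) (h0 : f 0 = 0) :
    (fun k => channel f w k -
      iteratedDeriv m f 0 / m.factorial * (moment w m / Real.pi ^ m) * k ^ m)
      =o[𝓝 0] fun k => k ^ m := by
  refine isLittleO_channel hm w (c := fun p => iteratedDeriv p f 0 / p.factorial) le_rfl
    (by simp [h0]) (fun _ hp hp' => absurd hp' hp.not_gt) ?_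
  have h := (hf.hasFPowerSeriesAt.isBigO_sub_partialSum_pow (m + 1)).trans_isLittleO
    (isLittleO_norm_left.1 (by
      simpa using (isLittleO_pow_pow (𝕜 := ℝ) (lt_add_one m)).norm_left))
  refine h.congr_left fun x => ?_
  simp [FormalMultilinearSeries.partialSum, FormalMultilinearSeries.ofScalars, mul_comm]

/-! ### Derivatives of the logarithm of a polynomial -/

section LogDerivatives

open Polynomial

/-- The numerator of the derivative of order `r + 1` of `log P`, over the denominator
`P ^ (r + 1)`. -/
def logDerivNumerator (P : ℝ[X]) : ℕ → ℝ[X]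
  | 0 => derivative P
  | r + 1 => derivative (logDerivNumerator P r) * P -
      C ((r : ℝ) + 1) * logDerivNumerator P r * derivative P

theorem iteratedDeriv_log_eval {P : ℝ[X]} (hP : ∀ x, 0 < P.eval x) (r : ℕ) (x : ℝ) :
    iteratedDeriv (r + 1) (fun x => Real.log (P.eval x)) x =
      (logDerivNumerator P r).eval x / P.eval x ^ (r + 1) := by
  induction r generalizing x with
  | zero =>
    rw [zero_add, iteratedDeriv_one, pow_one]
    exact ((P.hasDerivAt x).log (hP x).ne').deriv
  | succ r ih =>
    rw [iteratedDeriv_succ, funext ih]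
    have hx := (hP x).ne'
    refine (((logDerivNumerator P r).hasDerivAt x).fun_div ((P.hasDerivAt x).fun_pow (r + 1))
      (pow_ne_zero _ hx)).deriv.trans ?_
    simp only [logDerivNumerator, eval_sub, eval_mul, eval_C, Nat.cast_add, Nat.cast_one,
      Nat.add_sub_cancel]
    field_simp
    ring

theorem coeff_X_mul_derivative (P : ℝ[X]) (j : ℕ) :
    (X * derivative P).coeff j = j * P.coeff j := by
  cases j with
  | zero => simp
  | succ j => rw [coeff_X_mul, coeff_derivative]; push_cast; ring

theorem natDegree_X_mul_derivative_le (P : ℝ[X]) : (X * derivative P).natDegree ≤ P.natDegree :=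
  natDegree_le_iff_coeff_eq_zero.2 fun j hj => by
    rw [coeff_X_mul_derivative, coeff_eq_zero_of_natDegree_lt hj, mul_zero]

/-- The derivatives of `log P` are nonzero rational functions. The degree of the numerator is
less than that of the denominator, so that the leading terms of the recursion cannot cancel. -/
theorem logDerivNumerator_ne_zero {P : ℝ[X]} (hP : 0 < P.natDegree) (r : ℕ) :
    logDerivNumerator P r ≠ 0 ∧
      (logDerivNumerator P r).natDegree < (r + 1) * P.natDegree := by
  have hP0 : P.leadingCoeff ≠ 0 := leadingCoeff_ne_zero.2 (ne_zero_of_natDegree_gt hP)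
  induction r with
  | zero =>
    refine ⟨fun h => ?_, ?_⟩
    · exact hP.ne' (derivative_eq_zero.1 h)
    · rw [zero_add, one_mul]
      exact natDegree_derivative_lt hP.ne'
  | succ r ih =>
    obtain ⟨h0, hdeg⟩ := ih
    set N := logDerivNumerator P r
    have hN0 : N.leadingCoeff ≠ 0 := leadingCoeff_ne_zero.2 h0
    have hX : X * logDerivNumerator P (r + 1) =
        (X * derivative N) * P - C ((r : ℝ) + 1) * (N * (X * derivative P)) := by
      rw [logDerivNumerator]
      ring
    have hcoeff : (X * logDerivNumerator P (r + 1)).coeff (N.natDegree + P.natDegree) =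
        ((N.natDegree : ℝ) - (r + 1) * P.natDegree) * (N.leadingCoeff * P.leadingCoeff) := by
      rw [hX, coeff_sub, coeff_C_mul, coeff_mul_add_eq_of_natDegree_le
        (natDegree_X_mul_derivative_le N) le_rfl, coeff_mul_add_eq_of_natDegree_le le_rfl
        (natDegree_X_mul_derivative_le P), coeff_X_mul_derivative, coeff_X_mul_derivative]
      simp only [coeff_natDegree]
      ring
    have hne : logDerivNumerator P (r + 1) ≠ 0 := by
      intro h
      rw [h, mul_zero, coeff_zero] at hcoeff
      have hlt : (N.natDegree : ℝ) < (r + 1) * P.natDegree := by exact_mod_cast hdeg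
      exact mul_ne_zero (sub_neg.2 hlt).ne (mul_ne_zero hN0 hP0) hcoeff.symm
    refine ⟨hne, ?_⟩
    have hle : (X * logDerivNumerator P (r + 1)).natDegree ≤ N.natDegree + P.natDegree := by
      rw [hX]
      refine (natDegree_sub_le _ _).trans (max_le ?_ ?_)
      · exact natDegree_mul_le.trans (Nat.add_le_add_right (natDegree_X_mul_derivative_le N) _)
      · exact (natDegree_C_mul_le _ _).trans
          (natDegree_mul_le.trans (Nat.add_le_add_left (natDegree_X_mul_derivative_le P) _))
    rw [natDegree_X_mul hne] at hle
    nlinarith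

end LogDerivatives

/-! ### The information does not vanish identically -/

theorem corrMatrix_add_two_pi_mul (k : ℝ) (j : ℕ) (B : Finset ℕ) :
    corrMatrix (k + j * (2 * Real.pi)) B =
      corrMatrix k B + algebraMap ℝ (Matrix B B ℝ) (2 * j) := by
  ext x y
  have := Real.pi_ne_zero
  rw [Matrix.add_apply, corrMatrix_apply, corrMatrix_apply, Matrix.algebraMap_matrix_apply]
  split_ifs with h
  · simp only [Algebra.algebraMap_self, RingHom.id_apply]
    field_simp
  · rw [add_zero]
    congr 1
    have : (k + j * (2 * Real.pi)) * ((x : ℕ) - (y : ℕ) : ℝ) =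
        k * ((x : ℕ) - (y : ℕ) : ℝ) + ((j * ((x : ℕ) - (y : ℕ)) : ℤ) : ℝ) * (2 * Real.pi) := by
      push_cast
      ring
    rw [this, Real.sin_add_int_mul_two_pi]

/-- A shift of the Fermi momentum by a period shifts the spectrum by `2`. -/
theorem channel_log_eval_add_two_pi_mul {P : Polynomial ℝ} (hP : ∀ x, 0 < P.eval x) (c k : ℝ)
    (j : ℕ) (w : Fin m → ℕ) :
    channel (fun x => Real.log (P.eval x) / c) w (k + j * (2 * Real.pi)) =
      channel (fun x => Real.log (P.eval (x + 2 * j)) / c) w k := by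
  refine inclExcl_congr fun X _ => ?_
  have h : ∀ x, (P.comp (Polynomial.X + Polynomial.C (2 * (j : ℝ)))).eval x =
      P.eval (x + 2 * j) := fun x => by
    rw [Polynomial.eval_comp, Polynomial.eval_add, Polynomial.eval_X, Polynomial.eval_C]
  have h2 := spectralSum_log_eval (P := P.comp (Polynomial.X + Polynomial.C (2 * (j : ℝ))))
    (fun x => by rw [h]; exact hP _) c k (block w X)
  simp only [h] at h2
  rw [h2, spectralSum_log_eval hP, corrMatrix_add_two_pi_mul, Polynomial.aeval_comp, map_add,
    Polynomial.aeval_X, Polynomial.aeval_C]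

theorem natDegree_renyiPolynomial_pos {n : ℕ} (hn : 2 ≤ n) :
    0 < (renyiPolynomial n).natDegree := by
  by_contra h
  obtain ⟨a, ha⟩ := Polynomial.natDegree_eq_zero.1 (Nat.eq_zero_of_not_pos h)
  have h0 := eval_renyiPolynomial n 0
  have h2 := eval_renyiPolynomial n 2
  rw [← ha, Polynomial.eval_C] at h0 h2
  rw [h0] at h2
  have h4 : (2 : ℝ) ^ 2 ≤ 2 ^ n := pow_le_pow_right₀ one_le_two hn
  have hn0 : n ≠ 0 := by omega
  rcases neg_one_pow_eq_or ℝ n with h | h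
  · norm_num [h, hn0] at h2
  · norm_num [h, hn0] at h2 h4
    linarith

/-- If the information vanished near `0` it would vanish on the whole line. Near the momenta
`2 π j`, where the spectrum is close to `2 j`, this forces the derivative of order `m` of
`log (x ^ n + (1 - x) ^ n)`, a nonzero rational function, to vanish at all even integers. -/
theorem not_eventually_renyiInfo_natCast_eq_zero (hm : 0 < m) {w : Fin m → ℕ}
    (hw : ∀ i, 0 < w i) {n : ℕ} (hn : 2 ≤ n) : ¬ ∀ᶠ k in 𝓝 0, renyiInfo n w k = 0 := by
  intro h
  have hzero : ∀ k, renyiInfo n w k = 0 := fun k =>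
    AnalyticOnNhd.eqOn_zero_of_preconnected_of_eventuallyEq_zero (U := Set.univ)
      (fun k _ => analyticAt_renyiInfo_natCast n w k) isPreconnected_univ (Set.mem_univ 0) h
      (Set.mem_univ k)
  set P := renyiPolynomial n with hPdef
  have hP : ∀ x, 0 < P.eval x := eval_renyiPolynomial_pos n
  have hn1 : (1 - n : ℝ) ≠ 0 := by
    have : (2 : ℝ) ≤ n := by exact_mod_cast hn
    linarith
  have hderiv : ∀ j : ℕ, iteratedDeriv m (fun x => Real.log (P.eval x)) (2 * j) = 0 := by
    intro j
    set f : ℝ → ℝ := fun x => Real.log (P.eval (x + 2 * j)) / (1 - n) with hf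
    have hch : ∀ k, channel f w k = 0 := fun k => by
      rw [hf, ← channel_log_eval_add_two_pi_mul hP, ← renyiInfo_natCast, hzero]
    -- the constant `f 0` does not contribute either, as `C = 0` at `k = 0`
    have hconst : ∀ k, channel (fun _ => f 0) w k = 0 := by
      intro k
      refine Eq.trans (b := channel f w 0) ?_ (hch 0)
      refine inclExcl_congr fun X _ => Finset.sum_congr rfl fun i _ => ?_
      have := abs_eigenvalue_le 0 (block w X) i
      rw [abs_zero, mul_zero] at this
      rw [abs_nonpos_iff.1 this]
    have hfan : AnalyticAt ℝ f 0 :=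
      (((analyticAt_polynomial_eval P _).comp (f := fun x : ℝ => x + 2 * j)
        (by fun_prop)).log (hP _)).div_const
    have hlo := isLittleO_channel_of_analyticAt hm w (f := fun x => f x - f 0)
      (hfan.sub analyticAt_const) (sub_self _)
    have hch' : ∀ k, channel (fun x => f x - f 0) w k = 0 := fun k => by
      have := channel_add (fun x => f x - f 0) (fun _ => f 0) w k
      simp only [sub_add_cancel] at this
      rwa [hconst, add_zero, hch, eq_comm] at this
    simp only [hch', zero_sub] at hlo
    have hc : iteratedDeriv m (fun x => f x - f 0) 0 = 0 := by
      by_contra hne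
      have hcoef : iteratedDeriv m (fun x => f x - f 0) 0 / m.factorial *
          (moment w m / Real.pi ^ m) ≠ 0 :=
        mul_ne_zero (div_ne_zero hne (Nat.cast_ne_zero.2 m.factorial_ne_zero))
          (div_ne_zero (moment_ne_zero hm hw le_rfl) (pow_ne_zero _ Real.pi_ne_zero))
      have h1 := (isLittleO_const_mul_left_iff hcoef).1 (isLittleO_neg_left.1 hlo)
      have h2 := isLittleO_irrefl' (f' := fun k : ℝ => k ^ m) (l := 𝓝[≠] (0 : ℝ))
        (Eventually.frequently (eventually_nhdsWithin_of_forall fun k hk =>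
          norm_ne_zero_iff.2 (pow_ne_zero m hk)))
      exact h2 (h1.mono nhdsWithin_le_nhds)
    simp only [sub_eq_neg_add (f _)] at hc
    rw [iteratedDeriv_const_add hm, hf, iteratedDeriv_div_const,
      iteratedDeriv_comp_add_const (f := fun x => Real.log (P.eval x))] at hc
    simpa only [zero_add] using (div_eq_zero_iff.1 hc).resolve_right hn1
  obtain ⟨r, rfl⟩ := Nat.exists_eq_add_of_lt hm
  rw [zero_add] at hderiv
  refine (logDerivNumerator_ne_zero (natDegree_renyiPolynomial_pos hn) r).1
    (Polynomial.eq_zero_of_infinite_isRoot _ (Set.infinite_of_injective_forall_mem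
      (f := fun j : ℕ => 2 * (j : ℝ)) (fun a b hab => by simpa using hab) fun j => ?_))
  have h := hderiv j
  rw [iteratedDeriv_log_eval hP, div_eq_zero_iff] at h
  exact h.resolve_right (pow_ne_zero _ (hP _).ne')

/-! ### Scaling exponents at integer index -/

/-- The exponent is the order of vanishing at `0`, which is finite as the information does not
vanish identically. -/
theorem exists_hasScalingExponent_natCast (hm : 0 < m) {w : Fin m → ℕ} (hw : ∀ i, 0 < w i)
    {n : ℕ} (hn : 2 ≤ n) {c : ℝ}
    (hc : (fun k => renyiInfo n w k - c * k ^ m) =o[𝓝[>] 0] fun k : ℝ => k ^ m) :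
    ∃ β : ℝ, (m : ℝ) ≤ β ∧ HasScalingExponent (renyiInfo n w) β := by
  obtain ⟨q, g, hg, hg0, hq⟩ :=
    (analyticAt_renyiInfo_natCast n w 0).exists_eventuallyEq_pow_smul_nonzero_iff.2
      (not_eventually_renyiInfo_natCast_eq_zero hm hw hn)
  have hlim : Tendsto (fun k => renyiInfo n w k / k ^ q) (𝓝[>] 0) (𝓝 (g 0)) := by
    refine (hg.continuousAt.tendsto.mono_left nhdsWithin_le_nhds).congr' ?_
    filter_upwards [nhdsWithin_le_nhds hq, self_mem_nhdsWithin] with k hk hk0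
    rw [hk, sub_zero, smul_eq_mul, mul_div_cancel_left₀ _ (pow_ne_zero q (ne_of_gt hk0))]
  refine ⟨q, ?_, g 0, hg0, by simpa only [Real.rpow_natCast] using hlim⟩
  by_contra hlt
  have hlt : q < m := by exact_mod_cast not_le.1 hlt
  have hO : renyiInfo n w =O[𝓝[>] 0] fun k : ℝ => k ^ m := by
    simpa using hc.isBigO.add (isBigO_const_mul_self c (fun k : ℝ => k ^ m) (𝓝[>] 0))
  have ho := hO.trans_isLittleO ((isLittleO_pow_pow hlt).mono nhdsWithin_le_nhds)
  exact hg0 (tendsto_nhds_unique hlim ho.tendsto_div_nhds_zero)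

theorem isLittleO_renyiInfo_natCast (hm : 0 < m) (w : Fin m → ℕ) {n : ℕ} (hn : 2 ≤ n) :
    (fun k : ℝ => renyiInfo n w k - iteratedDeriv m (renyiFun n) 0 / m.factorial *
      (moment w m / Real.pi ^ m) * k ^ m) =o[𝓝[>] 0] (fun k : ℝ => k ^ m) := by
  have hn0 : n ≠ 0 := by omega
  exact (isLittleO_channel_of_analyticAt hm w (analyticAt_renyiFun_natCast n 0)
    (by simp [renyiFun_natCast, eval_renyiPolynomial, hn0])).mono nhdsWithin_le_nhds

/-- Integration of an asymptotic bound, by the mean value inequality on `[-|x|, |x|]`. -/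
theorem isLittleO_of_hasDerivAt {g g' : ℝ → ℝ} {q : ℕ} (hg : ∀ x, HasDerivAt g (g' x) x)
    (h0 : g 0 = 0) (hg' : g' =O[𝓝 0] fun x => x ^ q) : g =o[𝓝 0] fun x => x ^ q := by
  obtain ⟨c, hc⟩ := hg'.bound
  obtain ⟨δ, hδ, hball⟩ := Metric.eventually_nhds_iff_ball.1 hc
  suffices g =O[𝓝 0] fun x => x ^ (q + 1) from
    this.trans_isLittleO (isLittleO_pow_pow (lt_add_one q))
  refine IsBigO.of_bound |c| ?_
  filter_upwards [Metric.ball_mem_nhds 0 hδ] with x hx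
  have hx' : |x| < δ := by simpa using hx
  have h := (convex_closedBall (0 : ℝ) |x|).norm_image_sub_le_of_norm_hasDerivWithin_le
    (f := g) (C := |c| * |x| ^ q) (fun y _ => (hg y).hasDerivWithinAt) (fun y hy => ?_)
    (Metric.mem_closedBall_self (abs_nonneg x)) (y := x) (by simp)
  · simpa [h0, pow_succ, mul_assoc] using h
  · have hy : |y| ≤ |x| := by simpa using hy
    refine (hball y (by simpa using hy.trans_lt hx')).trans ?_
    rw [norm_pow, Real.norm_eq_abs]
    exact mul_le_mul (le_abs_self c) (pow_le_pow_left₀ (abs_nonneg y) hy q) (by positivity)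
      (abs_nonneg c)

/-- A polynomial `T` is the Taylor polynomial of order `q` of the Rényi function if the
derivatives agree up to a multiple of `x ^ q`. -/
theorem isLittleO_renyiFun_natCast_sub {n q : ℕ} (hn : 2 ≤ n) {T R : Polynomial ℝ}
    (hT0 : T.eval 0 = 0) (hT : (renyiPolynomial n).derivative -
      Polynomial.C (1 - n : ℝ) * T.derivative * renyiPolynomial n = Polynomial.X ^ q * R) :
    (fun x => renyiFun n x - T.eval x) =o[𝓝 0] fun x => x ^ q := by
  have hn0 : n ≠ 0 := by omega
  have hn1 : (1 - n : ℝ) ≠ 0 := by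
    have : (2 : ℝ) ≤ n := by exact_mod_cast hn
    linarith
  refine isLittleO_of_hasDerivAt (g' := fun x => x ^ q *
    (R.eval x / ((renyiPolynomial n).eval x * (1 - n)))) (fun x => ?_) ?_ ?_
  · rw [funext (renyiFun_natCast n)]
    have hx := (eval_renyiPolynomial_pos n x).ne'
    refine (((((renyiPolynomial n).hasDerivAt x).log hx).div_const _).sub
      (T.hasDerivAt x)).congr_deriv ?_
    have h := congrArg (Polynomial.eval x) hT
    simp only [Polynomial.eval_sub, Polynomial.eval_mul, Polynomial.eval_pow, Polynomial.eval_C,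
      Polynomial.eval_X] at h
    field_simp
    rw [← h]
    ring
  · simp [renyiFun_natCast, eval_renyiPolynomial, hn0, hT0]
  · have hcont : ContinuousAt (fun x => R.eval x / ((renyiPolynomial n).eval x * (1 - n))) 0 :=
      R.continuousAt.div ((renyiPolynomial n).continuousAt.mul continuousAt_const)
        (mul_ne_zero (eval_renyiPolynomial_pos n 0).ne' hn1)
    simpa using (isBigO_refl (fun x : ℝ => x ^ q) (𝓝 0)).mul (hcont.tendsto.isBigO_one ℝ)

/-- A polynomial `T` certified as a Taylor polynomial by the quotient `R` determines the exponent
if its coefficient of order `q` is the first nonzero one from order `m` on. -/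
theorem hasScalingExponent_of_taylor (hm : 0 < m) {w : Fin m → ℕ} (hw : ∀ i, 0 < w i) {n q : ℕ}
    (hn : 2 ≤ n) (hmq : m ≤ q) {T R : Polynomial ℝ} (hdeg : T.natDegree ≤ q)
    (hT0 : T.coeff 0 = 0) (hTq : T.coeff q ≠ 0) (hTm : ∀ p, m ≤ p → p < q → T.coeff p = 0)
    (hT : (renyiPolynomial n).derivative -
      Polynomial.C (1 - n : ℝ) * T.derivative * renyiPolynomial n = Polynomial.X ^ q * R) :
    HasScalingExponent (renyiInfo n w) q := by
  have h := isLittleO_renyiFun_natCast_sub hn (by rwa [← Polynomial.coeff_zero_eq_eval_zero]) hT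
  simp only [Polynomial.eval_eq_sum_range' (Nat.lt_succ_of_le hdeg)] at h
  refine hasScalingExponent_of_isLittleO (c := T.coeff q * (moment w q / Real.pi ^ q))
    (mul_ne_zero hTq (div_ne_zero (moment_ne_zero hm hw hmq) (pow_ne_zero _ Real.pi_ne_zero))) ?_
  simp only [Real.rpow_natCast]
  exact (isLittleO_channel hm w hmq hT0 hTm h).mono nhdsWithin_le_nhds

/-! ### Three and four strips -/

section ThreeAndFourStrips

open Polynomial

theorem hasScalingExponent_three_strips_two {w : Fin 3 → ℕ} (hw : ∀ i, 0 < w i) :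
    HasScalingExponent (renyiInfo 2 w) 3 := by
  have h := hasScalingExponent_of_taylor three_pos hw le_rfl (q := 3) le_rfl
    (T := C 2 * X - C (4 / 3) * X ^ 3) (R := C 8 - C 8 * X)
    (by compute_degree) (by simp) (by simp) (fun p hp hp' => by omega)
    (Polynomial.funext fun x => by simp [renyiPolynomial, derivative_pow]; ring)
  exact_mod_cast h

theorem hasScalingExponent_four_strips_two {w : Fin 4 → ℕ} (hw : ∀ i, 0 < w i) :
    HasScalingExponent (renyiInfo 2 w) 4 := by
  have h := hasScalingExponent_of_taylor four_pos hw le_rfl (q := 4) le_rfl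
    (T := C 2 * X - C (4 / 3) * X ^ 3 - C 2 * X ^ 4) (R := C 8 - C 16 * X)
    (by compute_degree) (by simp) (by simp) (fun p hp hp' => by omega)
    (Polynomial.funext fun x => by simp [renyiPolynomial, derivative_pow]; ring)
  exact_mod_cast h

/-- The cubic Taylor coefficient vanishes at index three, which raises the exponent of three strips
to four. -/
theorem hasScalingExponent_three {m : ℕ} (hm : m = 3 ∨ m = 4) {w : Fin m → ℕ}
    (hw : ∀ i, 0 < w i) : HasScalingExponent (renyiInfo 3 w) 4 := by
  have h := hasScalingExponent_of_taylor (by omega) hw (by norm_num : 2 ≤ 3) (q := 4) (by omega)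
    (T := C (3 / 2) * X + C (3 / 4) * X ^ 2 - C (9 / 8) * X ^ 4) (R := C 27 - C 27 * X)
    (by compute_degree) (by simp) (by simp)
    (fun p hp hp' => by
      obtain rfl : p = 3 := by omega
      simp)
    (Polynomial.funext fun x => by simp [renyiPolynomial, derivative_pow]; ring)
  exact_mod_cast h

/-- The quartic Taylor coefficient vanishes at index four. -/
theorem hasScalingExponent_four_strips_four {w : Fin 4 → ℕ} (hw : ∀ i, 0 < w i) :
    HasScalingExponent (renyiInfo 4 w) 5 := by
  have h := hasScalingExponent_of_taylor four_pos hw (by norm_num : 2 ≤ 4) (q := 5) (by norm_num)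
    (T := C (4 / 3) * X + C (2 / 3) * X ^ 2 + C (4 / 9) * X ^ 3 - C (16 / 15) * X ^ 5)
    (R := C 56 - C 88 * X + C 64 * X ^ 2 - C 32 * X ^ 3)
    (by compute_degree) (by simp) (by simp)
    (fun p hp hp' => by
      obtain rfl : p = 4 := by omega
      simp)
    (Polynomial.funext fun x => by simp [renyiPolynomial, derivative_pow]; ring)
  exact_mod_cast h

end ThreeAndFourStrips

end FreeFermion

end

theorem theorem1 {m : ℕ} (hm : 0 < m) (w : Fin m → ℕ) (hw : ∀ i, 0 < w i) :
    -- non-integer index: the master formula with its two channels, and the exponent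
    (∀ α : ℝ, 0 < α → (∀ n : ℕ, α ≠ n) →
      FreeFermion.fracMoment w α ≠ 0 ∧ FreeFermion.fracCoeff w α ≠ 0 ∧
      FreeFermion.moment w m ≠ 0 ∧ FreeFermion.polyCoeff w α ≠ 0 ∧
      (∀ᶠ k : ℝ in 𝓝[>] 0, FreeFermion.renyiInfo α w k =
        FreeFermion.channel (FreeFermion.renyiFrac α) w k +
          FreeFermion.channel (FreeFermion.renyiPoly α) w k) ∧
      (fun k : ℝ => FreeFermion.channel (FreeFermion.renyiFrac α) w k -
        FreeFermion.fracCoeff w α * k ^ α) =o[𝓝[>] 0] (fun k : ℝ => k ^ α) ∧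
      (fun k : ℝ => FreeFermion.channel (FreeFermion.renyiPoly α) w k -
        FreeFermion.polyCoeff w α * k ^ m) =o[𝓝[>] 0] (fun k : ℝ => k ^ m) ∧
      (fun k : ℝ => FreeFermion.renyiInfo α w k -
        (FreeFermion.fracCoeff w α * k ^ α + FreeFermion.polyCoeff w α * k ^ m))
          =o[𝓝[>] 0] (fun k : ℝ => k ^ min α (m : ℝ)) ∧
      FreeFermion.HasScalingExponent (FreeFermion.renyiInfo α w) (min α (m : ℝ))) ∧
    -- integer index: no fractional powers, and exponent at least `m`
    (∀ n : ℕ, 2 ≤ n →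
      AnalyticAt ℝ (FreeFermion.renyiFun n) 0 ∧
      AnalyticAt ℝ (FreeFermion.renyiInfo n w) 0 ∧
      (n < m → FreeFermion.fracMoment w n = 0) ∧
      (fun k : ℝ => FreeFermion.renyiInfo n w k -
        iteratedDeriv m (FreeFermion.renyiFun n) 0 / m.factorial *
          (FreeFermion.moment w m / Real.pi ^ m) * k ^ m) =o[𝓝[>] 0] (fun k : ℝ => k ^ m) ∧
      ∃ β : ℝ, (m : ℝ) ≤ β ∧ FreeFermion.HasScalingExponent (FreeFermion.renyiInfo n w) β) ∧
    -- the anomalies for three and four strips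
    (m = 3 →
      FreeFermion.HasScalingExponent (FreeFermion.renyiInfo 2 w) 3 ∧
      FreeFermion.HasScalingExponent (FreeFermion.renyiInfo 3 w) 4) ∧
    (m = 4 →
      FreeFermion.HasScalingExponent (FreeFermion.renyiInfo 2 w) 4 ∧
      FreeFermion.HasScalingExponent (FreeFermion.renyiInfo 3 w) 4 ∧
      FreeFermion.HasScalingExponent (FreeFermion.renyiInfo 4 w) 5) := by
  refine ⟨fun α hα hn =>
    FreeFermion.renyiInfo_of_forall_ne_natCast hm hw hα hn, fun n hn => ?_, ?_, ?_⟩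
  · have h := FreeFermion.isLittleO_renyiInfo_natCast hm w hn
    exact ⟨FreeFermion.analyticAt_renyiFun_natCast n 0,
      FreeFermion.analyticAt_renyiInfo_natCast n w 0,
      FreeFermion.fracMoment_natCast_eq_zero hw (by omega), h,
      FreeFermion.exists_hasScalingExponent_natCast hm hw hn h⟩
  · rintro rfl
    exact ⟨FreeFermion.hasScalingExponent_three_strips_two hw,
      FreeFermion.hasScalingExponent_three (Or.inl rfl) hw⟩
  · rintro rfl
    exact ⟨FreeFermion.hasScalingExponent_four_strips_two hw,
      FreeFermion.hasScalingExponent_three (Or.inr rfl) hw,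
      FreeFermion.hasScalingExponent_four_strips_four hw⟩
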